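/- Fix a nonempty finite set $P$ of processes and a nonempty finite set $\Sigma$ of labels. A message sequence chart (MSC) over $P$ and $\Sigma$ is a tuple $M=(E,\to,\lhd,\mathrm{loc},\lambda)$ with a nonempty finite set $E$ of events, relations $\to,\lhd\subseteq E\times E$ and maps $\mathrm{loc}\colon E\to P$, $\lambda\colon E\to\Sigma$ such that, with $E_p=\{e\in E\mid \mathrm{loc}(e)=p\}$: (i) ${\to}\subseteq\bigcup_{p\in P}E_p\times E_p$, and for every $p\in P$ the relation ${\to}\cap(E_p\times E_p)$ is the direct-successor relation of some total order on $E_p$; (ii) if $e\lhd f$, then $\mathrm{loc}(e)\neq\mathrm{loc}(f)$; each event belongs to at most one message edge (pair in $\lhd$); and for all $p\ne q$ and all message edges $(e,f),(e',f')\in E_p\times E_q$, $e\to^* e'$ iff $f\to^* f'$ (FIFO); (iii) ${\to}\cup{\lhd}$ is acyclic. Put ${\le}=({\to}\cup{\lhd})^*$. Isomorphic MSCs are identified. An event is internal if it belongs to no message edge. A sentence of $\mathrm{FO}[\to,\lhd,\le]$ is a first-order sentence, with variables ranging over events, built from the atomic formulas $p(x)$ (meaning $\mathrm{loc}(x)=p$),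 $a(x)$ (meaning $\lambda(x)=a$), $x=y$, $x\to y$, $x\lhd y$, $x\le y$, where $p\in P$ and $a\in\Sigma$. For a sentence $\Phi$, let $\mathbb L(\Phi)$ be the set of MSCs $M$ over $P$ and $\Sigma$ with $M\models\Phi$. A communicating finite-state machine (CFM) $\mathcal A$ over $P$ and $\Sigma$ consists of a finite set $\mathit{Msg}$ of messages, for each $p\in P$ a finite set $S_p$ of states, an initial state $\iota_p\in S_p$ and a set $\Delta_p\subseteq S_p\times \mathit{Act}_p\times S_p$ of transitions (source, action, target), and an acceptance condition $\mathit{Acc}\subseteq\prod_{p\in P}S_p$. Here $\mathit{Act}_p$ consists of the internal actions with label $a$, the actions "send $m$ to $q$ with label $a$", and the actions "receive $m$ from $q$ with label $a$", for $a\in\Sigma$, $m\in\mathit{Msg}$, $q\in P\setminus\{p\}$. A run of $\mathcal A$ on an MSC $M$ assigns to each $e\in E_p$ (for each $p\in P$) a transition $\rho(e)\in\Delta_p$ whose label is $\lambda(e)$, such that: if $e$ is $\to$-minimal, the source of $\rho(e)$ is $\iota_{\mathrm{loc}(e)}$; if $e\to f$, the target of $\rho(e)$ is the source of $\rho(f)$;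 if $e$ is internal, $\rho(e)$ is an internal transition; and if $e\lhd f$, then for some $m\in\mathit{Msg}$ the transition $\rho(e)$ sends $m$ to $\mathrm{loc}(f)$ and $\rho(f)$ receives $m$ from $\mathrm{loc}(e)$. The run is accepting if $(s_p)_{p\in P}\in\mathit{Acc}$, where $s_p$ is the target of the transition at the last event of $E_p$ if $E_p\ne\emptyset$, and $s_p=\iota_p$ otherwise. Let $\mathbb L(\mathcal A)$ be the set of MSCs over $P$ and $\Sigma$ on which $\mathcal A$ has an accepting run. **Proposition.** For every sentence $\Phi$ of $\mathrm{FO}[\to,\lhd,\le]$ there is a CFM $\mathcal A$ over $P$ and $\Sigma$ with $\mathbb L(\mathcal A)=\mathbb L(\Phi)$; that is, $\mathcal L(\mathrm{FO}[\to,\lhd,\le])\subseteq\mathcal L(\mathrm{CFM})$. -/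

import Mathlib

universe u v

/-- A message sequence chart over the processes `P` and the labels `A`. -/
structure MSC (P : Type u) (A : Type v) where
  /-- the events -/
  E : Type
  finite_E : Finite E
  nonempty_E : Nonempty E
  /-- the process edges `→` -/
  next : E → E → Prop
  /-- the message edges `◁` -/
  msg : E → E → Prop
  /-- the process executing an event -/
  loc : E → P
  /-- the label of an event -/
  lab : E → A
  /-- process edges stay on one process -/
  next_loc : ∀ e f, next e f → loc e = loc f
  /-- on each process, `→` is the direct-successor relation of some total order -/
  next_covBy : ∀ p : P, ∃ _ : LinearOrder {e : E // loc e = p},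
    ∀ e f : {e : E // loc e = p}, next e.1 f.1 ↔ e ⋖ f
  /-- messages go between distinct processes -/
  msg_loc : ∀ e f, msg e f → loc e ≠ loc f
  /-- two message edges that share an event are equal -/
  msg_unique : ∀ e f e' f', msg e f → msg e' f' →
    (e = e' ∨ e = f' ∨ f = e' ∨ f = f') → e = e' ∧ f = f'
  /-- every channel is FIFO -/
  fifo : ∀ e f e' f', msg e f → msg e' f' → loc e = loc e' → loc f = loc f' →
    (Relation.ReflTransGen next e e' ↔ Relation.ReflTransGen next f f')
  /-- `→ ∪ ◁` is acyclic -/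
  acyclic : ∀ e, ¬ Relation.TransGen (fun x y => next x y ∨ msg x y) e e

namespace MSC

variable {P : Type u} {A : Type v}

/-- The happened-before relation `≤ = (→ ∪ ◁)*`. -/
def le (M : MSC P A) : M.E → M.E → Prop :=
  Relation.ReflTransGen (fun x y => M.next x y ∨ M.msg x y)

/-- The process order `≤_proc = →*`. -/
def leProc (M : MSC P A) : M.E → M.E → Prop :=
  Relation.ReflTransGen M.next

/-- The set `E_p` of events located on the process `p`. -/
abbrev On (M : MSC P A) (p : P) : Type :=
  {e : M.E // M.loc e = p}

/-- An internal event is neither a send nor a receive event. -/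
def IsInternal (M : MSC P A) (e : M.E) : Prop :=
  ∀ f, ¬ M.msg e f ∧ ¬ M.msg f e

end MSC

/-- The relation symbols `p(x)`, `a(x)`, `x → y`, `x ◁ y`, `x ≤ y`. -/
inductive MSCRel (P : Type u) (A : Type v) : ℕ → Type (max u v)
  | proc (p : P) : MSCRel P A 1
  | label (a : A) : MSCRel P A 1
  | next : MSCRel P A 2
  | msg : MSCRel P A 2
  | le : MSCRel P A 2

/-- The signature of the logic `FO[→, ◁, ≤]` (equality is part of first-order logic). -/
def mscSignature (P : Type u) (A : Type v) : FirstOrder.Language.{0, max u v} where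
  Functions := fun _ => Empty
  Relations := MSCRel P A

/-- The interpretation of an atomic formula in an MSC. -/
def MSC.atom {P : Type u} {A : Type v} (M : MSC P A) :
    {n : ℕ} → MSCRel P A n → (Fin n → M.E) → Prop
  | _, .proc p, x => M.loc (x 0) = p
  | _, .label a, x => M.lab (x 0) = a
  | _, .next, x => M.next (x 0) (x 1)
  | _, .msg, x => M.msg (x 0) (x 1)
  | _, .le, x => M.le (x 0) (x 1)

/-- An MSC as a first-order structure. -/
instance MSC.instStructure {P : Type u} {A : Type v} (M : MSC P A) :
    (mscSignature P A).Structure M.E where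
  funMap := fun f _ => Empty.elim f
  RelMap := fun r x => M.atom r x

/-- The language of a first-order sentence: the set of MSCs that satisfy it. -/
def foLanguage {P : Type u} {A : Type v} (φ : (mscSignature P A).Sentence) : Set (MSC P A) :=
  {M | FirstOrder.Language.Sentence.Realize M.E φ}

/-- The class of the languages of sentences of `FO[→, ◁, ≤]`. -/
def FODefinable (P : Type u) (A : Type v) : Set (Set (MSC P A)) :=
  {L | ∃ φ : (mscSignature P A).Sentence, L = foLanguage φ}

/-- The actions of the process `p` over the set `Msg` of messages. -/
inductive CFMAction {P : Type u} (A : Type v) (Msg : Type) (p : P) : Type (max u v)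
  /-- an internal action with label `a` -/
  | internal (a : A) : CFMAction A Msg p
  /-- send the message `m` to `q`, with label `a` -/
  | send (a : A) (m : Msg) (q : P) (hq : q ≠ p) : CFMAction A Msg p
  /-- receive the message `m` from `q`, with label `a` -/
  | receive (a : A) (m : Msg) (q : P) (hq : q ≠ p) : CFMAction A Msg p

namespace CFMAction

variable {P : Type u} {A : Type v} {Msg : Type} {p : P}

/-- The label of an action. -/
def label : CFMAction A Msg p → A
  | internal a => a
  | send a _ _ _ => a
  | receive a _ _ _ => a

/-- The action is internal. -/
def IsInternal (α : CFMAction A Msg p) : Prop :=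
  ∃ a, α = internal a

/-- The action sends the message `m` to the process `q`. -/
def IsSend (α : CFMAction A Msg p) (m : Msg) (q : P) : Prop :=
  ∃ a hq, α = send a m q hq

/-- The action receives the message `m` from the process `q`. -/
def IsReceive (α : CFMAction A Msg p) (m : Msg) (q : P) : Prop :=
  ∃ a hq, α = receive a m q hq

end CFMAction

/-- A communicating finite-state machine over the processes `P` and the labels `A`. -/
structure CFM (P : Type u) (A : Type v) where
  /-- the messages -/
  Msg : Type
  finite_Msg : Finite Msg
  /-- the states of each process -/
  S : P → Type
  finite_S : ∀ p, Finite (S p)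
  /-- the initial state of each process -/
  init : ∀ p, S p
  /-- the transitions (source, action, target) of each process -/
  trans : ∀ p, Set (S p × CFMAction A Msg p × S p)
  /-- the acceptance condition -/
  Acc : Set (∀ p, S p)

namespace CFM

variable {P : Type u} {A : Type v}

/-- A run of the CFM `C` on the MSC `M`. -/
structure Run (C : CFM P A) (M : MSC P A) where
  /-- the source of the transition taken at an event -/
  source : ∀ p, M.On p → C.S p
  /-- the action of the transition taken at an event -/
  act : ∀ p, M.On p → CFMAction A C.Msg p
  /-- the target of the transition taken at an event -/
  target : ∀ p, M.On p → C.S p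
  mem_trans : ∀ p (e : M.On p), (source p e, act p e, target p e) ∈ C.trans p
  label_eq : ∀ p (e : M.On p), (act p e).label = M.lab e.1
  source_init : ∀ p (e : M.On p), (∀ f, ¬ M.next f e.1) → source p e = C.init p
  target_source : ∀ p (e f : M.On p), M.next e.1 f.1 → target p e = source p f
  internal : ∀ p (e : M.On p), M.IsInternal e.1 → (act p e).IsInternal
  message : ∀ p q (e : M.On p) (f : M.On q), M.msg e.1 f.1 →
    ∃ m : C.Msg, (act p e).IsSend m q ∧ (act q f).IsReceive m p

/-- `s` is the state of the process `p` at the end of the run: the target of the transition at the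
last event of `p`, and the initial state if `p` has no event. -/
def Run.IsLast {C : CFM P A} {M : MSC P A} (ρ : C.Run M) (p : P) (s : C.S p) : Prop :=
  (∃ e : M.On p, (∀ f : M.On p, M.leProc f.1 e.1) ∧ s = ρ.target p e) ∨
    (IsEmpty (M.On p) ∧ s = C.init p)

/-- The run is accepting: the tuple of last states belongs to the acceptance condition. -/
def Run.Accepting {C : CFM P A} {M : MSC P A} (ρ : C.Run M) : Prop :=
  ∃ s ∈ C.Acc, ∀ p, ρ.IsLast p (s p)

/-- The language of a CFM: the set of MSCs on which it has an accepting run. -/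
def language (C : CFM P A) : Set (MSC P A) :=
  {M | ∃ ρ : C.Run M, ρ.Accepting}

end CFM

/-- The class of the languages of CFMs. -/
def CFMRecognizable (P : Type u) (A : Type v) : Set (Set (MSC P A)) :=
  {L | ∃ C : CFM P A, L = C.language}

/-! A CFM amounts to a system of local constraints on a labelling of the events by a finite set
(`LocSys`), the label being the state after the event. Properties recognizable in this way are
closed under conjunction and projection, but no complementation is available for them. The proof
therefore works with `Rec`: families of sets of events for which the labelling by membership, with
its negative values too, is recognizable. For these, negation is a mere relabelling. It remains to
bring formulas into a shape in which quantifiers never force a complementation.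

The shape is a positive Boolean combination (`Def`) of path expressions (`EvPath`), composed of
tests, moves along a process, message edges read either way, and jumps. Thanks to FIFO, a path
expression between two processes is a sublattice of a product of two chains (`EvPath.lattice`). So
the image of an event is an interval of the codomain (`EvPath.convex`), whose endpoints are again
given by path expressions (`EvPath.least`). Hence a failing path can be expressed positively
(`Def.not_lit`), and an existential quantifier asks for a common point of intervals. By Helly's
theorem it suffices that they meet pairwise, and two images meet exactly when the composition of one
path with the inverse of the other holds (`Clause.def_exists_of_ne_nil`).

The quantified event may also carry a constraint `R M y y`, so the diagonal of a path expression
must be recognizable (`EvPath.loop`). This is the heart of the proof. By convexity, the loop exists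
iff the event lies in the domain and the codomain, between the endpoints of its image. The endpoints
extend to total monotone functions on each process (`leastAfter`). To find out in which direction
such a function moves a point, cut the chain into blocks so that every moved point moves by one or
two blocks (`exists_blocks`). A CFM guesses the block numbers modulo 6, and monotonicity rules out
false claims (`blocks_sound`).

Finally, `≤` needs at most as many message edges as there are processes (`MSC.le_iff_reach`), so
every atomic formula is in `Def`. -/

variable {P : Type u} {A : Type v}

/-! ### Process orders, read in either direction -/

namespace MSC

variable (M : MSC P A)

instance instFiniteE : Finite M.E := M.finite_E

/-- The process edges, read forwards (`d = true`) or backwards (`d = false`). -/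
def nx (d : Bool) (e f : M.E) : Prop :=
  if d then M.next e f else M.next f e

theorem nx_not (d : Bool) (e f : M.E) : M.nx (!d) e f ↔ M.nx d f e := by
  cases d <;> simp [nx]

theorem exists_enum (d : Bool) (p : P) : ∃ n, ∃ σ : Fin n ≃ M.On p,
    ∀ i j, M.nx d (σ i).1 (σ j).1 ↔ i.1 + 1 = j.1 := by
  obtain ⟨inst, h⟩ := M.next_covBy p
  have : Fintype (M.On p) := Fintype.ofFinite _
  have σ : Fin (Fintype.card (M.On p)) ≃o M.On p := Fintype.orderIsoFinOfCardEq _ rfl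
  have hσ : ∀ i j, M.next (σ i).1 (σ j).1 ↔ i.1 + 1 = j.1 := by
    intro i j
    rw [h, apply_covBy_apply_iff, Fin.covBy_iff]
    simp [Nat.covBy_iff_add_one_eq]
  cases d with
  | true => exact ⟨_, σ.toEquiv, fun i j => by simpa [nx] using hσ i j⟩
  | false =>
    refine ⟨_, Fin.revPerm.trans σ.toEquiv, fun i j => ?_⟩
    have := hσ j.rev i.rev
    simp only [nx, Bool.false_eq_true, if_false]
    refine this.trans ?_
    simp only [Fin.val_rev]
    omega

/-- The number of events on the process `p`. -/
noncomputable def cnt (d : Bool) (p : P) : ℕ := (M.exists_enum d p).choose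

/-- The enumeration of the events of the process `p` in the direction `d`. -/
noncomputable def enum (d : Bool) (p : P) : Fin (M.cnt d p) ≃ M.On p :=
  (M.exists_enum d p).choose_spec.choose

theorem enum_nx (d : Bool) (p : P) (i j : Fin (M.cnt d p)) :
    M.nx d (M.enum d p i).1 (M.enum d p j).1 ↔ i.1 + 1 = j.1 :=
  (M.exists_enum d p).choose_spec.choose_spec i j

/-- The position of an event on its process, counted in the direction `d`. -/
noncomputable def pos (d : Bool) (e : M.E) : ℕ := ((M.enum d (M.loc e)).symm ⟨e, rfl⟩).1

/-- The process order in the direction `d`. -/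
def ord (d : Bool) (e f : M.E) : Prop := M.loc e = M.loc f ∧ M.pos d e ≤ M.pos d f

/-- The strict process order in the direction `d`. -/
def lt (d : Bool) (e f : M.E) : Prop := M.loc e = M.loc f ∧ M.pos d e < M.pos d f

variable {M}

theorem pos_lt_cnt (d : Bool) (e : M.E) : M.pos d e < M.cnt d (M.loc e) := Fin.is_lt _

theorem pos_enum (d : Bool) (p : P) (i : Fin (M.cnt d p)) : M.pos d (M.enum d p i).1 = i.1 := by
  have key : ∀ (x : M.On p), M.pos d x.1 = ((M.enum d p).symm x).1 := by
    rintro ⟨x, rfl⟩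
    rfl
  rw [key, Equiv.symm_apply_apply]

theorem pos_inj {d : Bool} {e f : M.E} (h : M.loc e = M.loc f) (hp : M.pos d e = M.pos d f) :
    e = f := by
  have key : ∀ (x : M.On (M.loc f)), M.pos d x.1 = ((M.enum d (M.loc f)).symm x).1 := by
    rintro ⟨x, hx⟩
    revert hx
    generalize M.loc f = q
    rintro rfl
    rfl
  have h1 := key ⟨e, h⟩
  have h2 := key ⟨f, rfl⟩
  have h3 : (M.enum d (M.loc f)).symm ⟨e, h⟩ = (M.enum d (M.loc f)).symm ⟨f, rfl⟩ :=
    Fin.ext (by rw [← h1, ← h2]; exact hp)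
  exact congrArg Subtype.val ((M.enum d (M.loc f)).symm.injective h3)

theorem exists_pos {d : Bool} {p : P} {k : ℕ} (hk : k < M.cnt d p) :
    ∃ f, M.loc f = p ∧ M.pos d f = k :=
  ⟨(M.enum d p ⟨k, hk⟩).1, (M.enum d p ⟨k, hk⟩).2, pos_enum ..⟩

theorem nx_loc {d : Bool} {e f : M.E} (h : M.nx d e f) : M.loc e = M.loc f := by
  cases d
  · exact (M.next_loc _ _ (by simpa [nx] using h)).symm
  · exact M.next_loc _ _ (by simpa [nx] using h)

theorem nx_iff {d : Bool} {e f : M.E} :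
    M.nx d e f ↔ M.loc e = M.loc f ∧ M.pos d e + 1 = M.pos d f := by
  have key : M.loc e = M.loc f → (M.nx d e f ↔ M.pos d e + 1 = M.pos d f) := by
    intro h
    obtain ⟨i, hi⟩ := (M.enum d (M.loc f)).surjective ⟨e, h⟩
    obtain ⟨j, hj⟩ := (M.enum d (M.loc f)).surjective ⟨f, rfl⟩
    have := M.enum_nx d (M.loc f) i j
    rw [← pos_enum, ← pos_enum, hi, hj] at this
    exact this
  exact ⟨fun h => ⟨nx_loc h, (key (nx_loc h)).1 h⟩, fun h => (key h.1).2 h.2⟩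

theorem ord_refl (d : Bool) (e : M.E) : M.ord d e e := ⟨rfl, le_rfl⟩

theorem ord.trans {d : Bool} {e f g : M.E} (h : M.ord d e f) (h' : M.ord d f g) : M.ord d e g :=
  ⟨h.1.trans h'.1, h.2.trans h'.2⟩

theorem ord.antisymm {d : Bool} {e f : M.E} (h : M.ord d e f) (h' : M.ord d f e) : e = f :=
  pos_inj h.1 (le_antisymm h.2 h'.2)

theorem lt.ord {d : Bool} {e f : M.E} (h : M.lt d e f) : M.ord d e f := ⟨h.1, h.2.le⟩

theorem lt.trans_ord {d : Bool} {e f g : M.E} (h : M.lt d e f) (h' : M.ord d f g) : M.lt d e g :=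
  ⟨h.1.trans h'.1, h.2.trans_le h'.2⟩

theorem ord.trans_lt {d : Bool} {e f g : M.E} (h : M.ord d e f) (h' : M.lt d f g) : M.lt d e g :=
  ⟨h.1.trans h'.1, h.2.trans_lt h'.2⟩

theorem lt.not_ord {d : Bool} {e f : M.E} (h : M.lt d e f) : ¬ M.ord d f e :=
  fun h' => absurd h.2 (not_lt.2 h'.2)

theorem ord_or_lt (d : Bool) {e f : M.E} (h : M.loc e = M.loc f) : M.ord d e f ∨ M.lt d f e := by
  rcases le_or_gt (M.pos d e) (M.pos d f) with h' | h'
  · exact Or.inl ⟨h, h'⟩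
  · exact Or.inr ⟨h.symm, h'⟩

theorem lt_iff {d : Bool} {e f : M.E} : M.lt d e f ↔ M.ord d e f ∧ e ≠ f := by
  constructor
  · rintro h
    exact ⟨h.ord, fun he => h.not_ord (he ▸ ord_refl d e)⟩
  · rintro ⟨h, hne⟩
    exact ⟨h.1, lt_of_le_of_ne h.2 fun h' => hne (pos_inj h.1 h')⟩

theorem eq_or_lt_of_ord {d : Bool} {e f : M.E} (h : M.ord d e f) : e = f ∨ M.lt d e f := by
  by_cases he : e = f
  · exact Or.inl he
  · exact Or.inr (lt_iff.2 ⟨h, he⟩)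

theorem nx.lt {d : Bool} {e f : M.E} (h : M.nx d e f) : M.lt d e f := by
  rw [nx_iff] at h
  exact ⟨h.1, by omega⟩

theorem nx.ord_of_lt {d : Bool} {e f g : M.E} (h : M.nx d e f) (h' : M.lt d e g) : M.ord d f g := by
  rw [nx_iff] at h
  exact ⟨h.1.symm.trans h'.1, by have := h'.2; omega⟩

theorem lt.exists_nx {d : Bool} {e f : M.E} (h : M.lt d e f) : ∃ g, M.nx d e g ∧ M.ord d g f := by
  have h1 := pos_lt_cnt d f
  have h2 := h.2
  obtain ⟨g, hg, hp⟩ := exists_pos (M := M) (d := d) (p := M.loc f) (k := M.pos d e + 1) (by omega)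
  have h3 : M.nx d e g := nx_iff.2 ⟨h.1.trans hg.symm, hp.symm⟩
  exact ⟨g, h3, h3.ord_of_lt h⟩

theorem lt.exists_nx' {d : Bool} {e f : M.E} (h : M.lt d e f) : ∃ g, M.nx d g f ∧ M.ord d e g := by
  have h1 := pos_lt_cnt d f
  have h2 := h.2
  obtain ⟨g, hg, hp⟩ := exists_pos (M := M) (d := d) (p := M.loc f) (k := M.pos d f - 1) (by omega)
  exact ⟨g, nx_iff.2 ⟨hg, by omega⟩, h.1.trans hg.symm, by omega⟩

theorem ord_iff_reflTransGen {d : Bool} {e f : M.E} :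
    M.ord d e f ↔ Relation.ReflTransGen (M.nx d) e f := by
  constructor
  · rintro h
    induction hk : M.pos d f - M.pos d e generalizing e with
    | zero =>
      obtain rfl := pos_inj h.1 (by have := h.2; omega : M.pos d e = M.pos d f)
      exact .refl
    | succ k ih =>
      obtain ⟨g, hg, hgf⟩ := lt.exists_nx (⟨h.1, by omega⟩ : M.lt d e f)
      exact .head hg (ih hgf (by have := (nx_iff.1 hg).2; omega))
  · intro h
    induction h with
    | refl => exact ord_refl d e
    | tail _ h ih => exact ih.trans h.lt.ord

theorem leProc_iff {e f : M.E} : M.leProc e f ↔ M.ord true e f := by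
  rw [ord_iff_reflTransGen]
  rfl

theorem ord_not {d : Bool} {e f : M.E} : M.ord (!d) e f ↔ M.ord d f e := by
  rw [ord_iff_reflTransGen, ord_iff_reflTransGen, ← Relation.reflTransGen_swap]
  have : M.nx (!d) = Function.swap (M.nx d) := by
    ext x y
    exact M.nx_not d x y
  rw [this]

theorem lt_not {d : Bool} {e f : M.E} : M.lt (!d) e f ↔ M.lt d f e := by
  rw [lt_iff, lt_iff, ord_not, ne_comm]

/-- A nonempty set of events of one process has a least element. -/
theorem exists_least (d : Bool) {p : P} {X : M.E → Prop} (h : ∃ e, X e) (hX : ∀ e, X e → M.loc e = p) :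
    ∃ e, X e ∧ ∀ f, X f → M.ord d e f := by
  obtain ⟨e, he, hmin⟩ := (Set.toFinite {e | X e}).exists_minimalFor (M.pos d) _ h
  refine ⟨e, he, fun f hf => ⟨(hX e he).trans (hX f hf).symm, ?_⟩⟩
  by_contra hc
  exact hc (hmin hf (by omega))

/-- Induction along a process, from its end in the direction `d`. -/
theorem nx_induction (d : Bool) {C : M.E → Prop}
    (h : ∀ e, (∀ f, M.nx d e f → C f) → C e) (e : M.E) : C e := by
  induction hk : M.cnt d (M.loc e) - M.pos d e using Nat.strong_induction_on generalizing e with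
  | _ k ih =>
    refine h e fun f hf => ih _ ?_ f rfl
    have h1 := nx_iff.1 hf
    have h2 := pos_lt_cnt d f
    rw [← h1.1] at *
    omega

theorem ord_of_last {d : Bool} {e f : M.E} (h : ∀ g, ¬ M.nx d e g) (hf : M.loc f = M.loc e) :
    M.ord d f e := by
  rcases ord_or_lt d hf with h1 | h1
  · exact h1
  · obtain ⟨g, hg, -⟩ := h1.exists_nx
    exact absurd hg (h g)

theorem nx_unique_left {d : Bool} {e f g : M.E} (h : M.nx d f e) (h' : M.nx d g e) : f = g := by
  rw [nx_iff] at h h'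
  exact pos_inj (d := d) (h.1.trans h'.1.symm) (by omega)

end MSC

/-! ### Last events of processes -/

namespace MSC

variable (M : MSC P A)

open Classical in
/-- The last event of the process `p`, if `p` has any event. -/
noncomputable def lastEv (p : P) : Option M.E :=
  if h : ∃ e, M.loc e = p ∧ ∀ f, M.loc f = p → M.leProc f e then some h.choose else none

variable {M}

theorem lastEv_eq_some {p : P} {e : M.E} :
    M.lastEv p = some e ↔ M.loc e = p ∧ ∀ f, M.loc f = p → M.leProc f e := by
  unfold lastEv
  split_ifs with h
  · rw [Option.some_inj]
    constructor
    · rintro rfl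
      exact h.choose_spec
    · intro he
      exact ord.antisymm (leProc_iff.1 (he.2 _ h.choose_spec.1))
        (leProc_iff.1 (h.choose_spec.2 _ he.1))
  · simp only [false_iff]
    exact fun he => h ⟨e, he⟩

theorem lastEv_eq_none {p : P} : M.lastEv p = none ↔ IsEmpty (M.On p) := by
  constructor
  · intro h
    refine ⟨fun x => ?_⟩
    obtain ⟨e, he, hl⟩ := exists_least (M := M) false (X := fun e => M.loc e = p) ⟨x.1, x.2⟩
      (fun _ h => h)
    have : M.lastEv p = some e :=
      lastEv_eq_some.2 ⟨he, fun f hf => leProc_iff.2 (ord_not.1 (hl f hf))⟩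
    simp [h] at this
  · intro h
    rcases hl : M.lastEv p with _ | e
    · rfl
    · exact (h.false ⟨e, (lastEv_eq_some.1 hl).1⟩).elim

theorem lastEv_loc_iff {e : M.E} : M.lastEv (M.loc e) = some e ↔ ∀ f, ¬ M.next e f := by
  rw [lastEv_eq_some]
  constructor
  · rintro h f hf
    have h1 : M.nx true e f := hf
    exact h1.lt.not_ord (leProc_iff.1 (h.2 f (nx_loc h1).symm))
  · intro h
    exact ⟨rfl, fun f hf => leProc_iff.2 (ord_of_last (d := true) h hf)⟩

end MSC

/-! ### Local constraint systems and recognizable properties -/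

/-- A system of local constraints on labellings of the events by elements of `S`. -/
structure LocSys (P : Type u) (A : Type v) (S : Type) where
  /-- the constraint at every event -/
  node : P → A → S → Prop
  /-- the constraint at the first event of a process -/
  first : S → Prop
  /-- the constraint on process edges -/
  edge : S → S → Prop
  /-- the constraint at internal events -/
  int : S → Prop
  /-- the constraint on message edges -/
  msg : P → S → P → S → Prop
  /-- the constraint on the labels of the last events -/
  acc : (P → Option S) → Prop

/-- The labelling `s` satisfies all the constraints. -/
structure LocSys.Valid {S : Type} (Γ : LocSys P A S) (M : MSC P A) (s : M.E → S) : Prop where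
  node : ∀ e, Γ.node (M.loc e) (M.lab e) (s e)
  first : ∀ e, (∀ f, ¬ M.next f e) → Γ.first (s e)
  edge : ∀ e f, M.next e f → Γ.edge (s e) (s f)
  int : ∀ e, M.IsInternal e → Γ.int (s e)
  msg : ∀ e f, M.msg e f → Γ.msg (M.loc e) (s e) (M.loc f) (s f)
  acc : Γ.acc fun p => (M.lastEv p).map s

/-- The local system without constraints. -/
def LocSys.triv (P : Type u) (A : Type v) (S : Type) : LocSys P A S where
  node _ _ _ := True
  first _ := True
  edge _ _ := True
  int _ := True
  msg _ _ _ _ := True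
  acc _ := True

/-- A property of labelled MSCs is recognizable if it is a projection of a local system. -/
def Recog {L : Type} (Φ : ∀ M : MSC P A, (M.E → L) → Prop) : Prop :=
  ∃ (S : Type) (_ : Finite S) (π : S → L) (Γ : LocSys P A S), ∀ (M : MSC P A) (ℓ : M.E → L),
    Φ M ℓ ↔ ∃ s : M.E → S, (∀ e, π (s e) = ℓ e) ∧ Γ.Valid M s

namespace Recog

variable {L K : Type}

theorem congr {Φ Ψ : ∀ M : MSC P A, (M.E → L) → Prop} (h : Recog Φ)
    (hΨ : ∀ M ℓ, Ψ M ℓ ↔ Φ M ℓ) : Recog Ψ := by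
  obtain ⟨S, hS, π, Γ, hΓ⟩ := h
  exact ⟨S, hS, π, Γ, fun M ℓ => (hΨ M ℓ).trans (hΓ M ℓ)⟩

theorem of_valid [Finite L] (Γ : LocSys P A L) : Recog (fun M ℓ => Γ.Valid M ℓ) :=
  ⟨L, inferInstance, id, Γ, fun M ℓ => ⟨fun h => ⟨ℓ, fun _ => rfl, h⟩, fun ⟨s, hs, h⟩ => by
    obtain rfl : s = ℓ := funext hs
    exact h⟩⟩

theorem node [Finite L] (φ : P → A → L → Prop) :
    Recog (P := P) (A := A) (fun M ℓ => ∀ e, φ (M.loc e) (M.lab e) (ℓ e)) :=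
  (of_valid { LocSys.triv P A L with node := φ }).congr fun _ _ =>
    ⟨fun h => ⟨h, fun _ _ => trivial, fun _ _ _ => trivial, fun _ _ => trivial,
      fun _ _ _ => trivial, trivial⟩, fun h => h.node⟩

theorem edge [Finite L] (d : Bool) (φ : L → L → Prop) :
    Recog (P := P) (A := A) (fun M ℓ => ∀ e f, M.nx d e f → φ (ℓ e) (ℓ f)) := by
  refine (of_valid
    { LocSys.triv P A L with edge := fun x y => if d then φ x y else φ y x }).congr fun M ℓ => ?_
  constructor
  · intro h
    refine ⟨fun _ => trivial, fun _ _ => trivial, fun e f hef => ?_, fun _ _ => trivial,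
      fun _ _ _ => trivial, trivial⟩
    cases d
    · exact h f e (by simpa [MSC.nx] using hef)
    · exact h e f (by simpa [MSC.nx] using hef)
  · intro h e f hef
    cases d
    · simpa using h.edge f e (by simpa [MSC.nx] using hef)
    · simpa using h.edge e f (by simpa [MSC.nx] using hef)

theorem int [Finite L] (φ : L → Prop) :
    Recog (P := P) (A := A) (fun M ℓ => ∀ e, M.IsInternal e → φ (ℓ e)) :=
  (of_valid { LocSys.triv P A L with int := φ }).congr fun _ _ =>
    ⟨fun h => ⟨fun _ => trivial, fun _ _ => trivial, fun _ _ _ => trivial, h,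
      fun _ _ _ => trivial, trivial⟩, fun h => h.int⟩

theorem msg [Finite L] (φ : P → L → P → L → Prop) : Recog (P := P) (A := A)
    (fun M ℓ => ∀ e f, M.msg e f → φ (M.loc e) (ℓ e) (M.loc f) (ℓ f)) :=
  (of_valid { LocSys.triv P A L with msg := φ }).congr fun _ _ =>
    ⟨fun h => ⟨fun _ => trivial, fun _ _ => trivial, fun _ _ _ => trivial, fun _ _ => trivial,
      h, trivial⟩, fun h => h.msg⟩

theorem acc [Finite L] (φ : (P → Option L) → Prop) :
    Recog (P := P) (A := A) (fun M ℓ => φ fun p => (M.lastEv p).map ℓ) :=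
  (of_valid { LocSys.triv P A L with acc := φ }).congr fun _ _ =>
    ⟨fun h => ⟨fun _ => trivial, fun _ _ => trivial, fun _ _ _ => trivial, fun _ _ => trivial,
      fun _ _ _ => trivial, h⟩, fun h => h.acc⟩

/-- Constraints at the last events of the processes in the direction `d`. -/
theorem last [Finite L] (d : Bool) (φ : L → Prop) :
    Recog (P := P) (A := A) (fun M ℓ => ∀ e, (∀ f, ¬ M.nx d e f) → φ (ℓ e)) := by
  cases d with
  | false =>
    exact (of_valid { LocSys.triv P A L with first := φ }).congr fun _ _ =>
      ⟨fun h => ⟨fun _ => trivial, by simpa [MSC.nx] using h, fun _ _ _ => trivial,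
        fun _ _ => trivial, fun _ _ _ => trivial, trivial⟩,
        fun h => by simpa [MSC.nx] using h.first⟩
  | true =>
    refine (acc (fun t => ∀ p x, t p = some x → φ x)).congr fun M ℓ => ?_
    simp only [Option.map_eq_some_iff, forall_exists_index, and_imp]
    constructor
    · rintro h p _ e he rfl
      obtain rfl := (MSC.lastEv_eq_some.1 he).1
      exact h e (by simpa [MSC.nx] using MSC.lastEv_loc_iff.1 he)
    · rintro h e he
      exact h _ _ e (MSC.lastEv_loc_iff.2 (by simpa [MSC.nx] using he)) rfl

theorem and {Φ Ψ : ∀ M : MSC P A, (M.E → L) → Prop} (h : Recog Φ) (h' : Recog Ψ) :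
    Recog (fun M ℓ => Φ M ℓ ∧ Ψ M ℓ) := by
  obtain ⟨S, hS, π, Γ, hΓ⟩ := h
  obtain ⟨S', hS', π', Γ', hΓ'⟩ := h'
  refine ⟨{x : S × S' // π x.1 = π' x.2}, inferInstance, fun x => π x.1.1,
    { node := fun p a x => Γ.node p a x.1.1 ∧ Γ'.node p a x.1.2
      first := fun x => Γ.first x.1.1 ∧ Γ'.first x.1.2
      edge := fun x y => Γ.edge x.1.1 y.1.1 ∧ Γ'.edge x.1.2 y.1.2
      int := fun x => Γ.int x.1.1 ∧ Γ'.int x.1.2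
      msg := fun p x q y => Γ.msg p x.1.1 q y.1.1 ∧ Γ'.msg p x.1.2 q y.1.2
      acc := fun t => Γ.acc (fun p => (t p).map fun x => x.1.1) ∧
        Γ'.acc (fun p => (t p).map fun x => x.1.2) }, fun M ℓ => ?_⟩
  refine (and_congr (hΓ M ℓ) (hΓ' M ℓ)).trans ?_
  constructor
  · rintro ⟨⟨s, hs, h⟩, s', hs', h'⟩
    refine ⟨fun e => ⟨(s e, s' e), (hs e).trans (hs' e).symm⟩, hs, ?_⟩
    refine ⟨fun e => ⟨h.node e, h'.node e⟩, fun e he => ⟨h.first e he, h'.first e he⟩,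
      fun e f he => ⟨h.edge e f he, h'.edge e f he⟩, fun e he => ⟨h.int e he, h'.int e he⟩,
      fun e f he => ⟨h.msg e f he, h'.msg e f he⟩, ?_, ?_⟩
    · simpa [Function.comp_def] using h.acc
    · simpa [Function.comp_def] using h'.acc
  · rintro ⟨s, hs, h⟩
    refine ⟨⟨fun e => (s e).1.1, hs, fun e => (h.node e).1, fun e he => (h.first e he).1,
      fun e f he => (h.edge e f he).1, fun e he => (h.int e he).1,
      fun e f he => (h.msg e f he).1, ?_⟩, ⟨fun e => (s e).1.2, fun e => ?_,
      fun e => (h.node e).2, fun e he => (h.first e he).2,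
      fun e f he => (h.edge e f he).2, fun e he => (h.int e he).2,
      fun e f he => (h.msg e f he).2, ?_⟩⟩
    · simpa [Function.comp_def] using h.acc.1
    · exact (s e).2.symm.trans (hs e)
    · simpa [Function.comp_def] using h.acc.2

/-- Nondeterminism absorbs the projection: the guessed component is simply forgotten by `π`. -/
theorem ex {Φ : ∀ M : MSC P A, (M.E → L × K) → Prop} (h : Recog Φ) :
    Recog (fun M (ℓ : M.E → L) => ∃ κ : M.E → K, Φ M fun e => (ℓ e, κ e)) := by
  obtain ⟨S, hS, π, Γ, hΓ⟩ := h
  refine ⟨S, hS, fun x => (π x).1, Γ, fun M ℓ => ?_⟩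
  simp only [hΓ]
  constructor
  · rintro ⟨κ, s, hs, h⟩
    exact ⟨s, fun e => by simp [hs], h⟩
  · rintro ⟨s, hs, h⟩
    exact ⟨fun e => (π (s e)).2, s, fun e => by rw [← hs], h⟩

theorem comap [Finite K] {Φ : ∀ M : MSC P A, (M.E → L) → Prop} (h : Recog Φ) (g : K → L) :
    Recog (fun M (ℓ : M.E → K) => Φ M fun e => g (ℓ e)) := by
  obtain ⟨S, hS, π, Γ, hΓ⟩ := h
  refine ⟨{x : S × K // π x.1 = g x.2}, inferInstance, fun x => x.1.2,
    { node := fun p a x => Γ.node p a x.1.1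
      first := fun x => Γ.first x.1.1
      edge := fun x y => Γ.edge x.1.1 y.1.1
      int := fun x => Γ.int x.1.1
      msg := fun p x q y => Γ.msg p x.1.1 q y.1.1
      acc := fun t => Γ.acc (fun p => (t p).map fun x => x.1.1) }, fun M ℓ => ?_⟩
  refine (hΓ M _).trans ?_
  constructor
  · rintro ⟨s, hs, h⟩
    exact ⟨fun e => ⟨(s e, ℓ e), hs e⟩, fun _ => rfl, h.node, h.first, h.edge, h.int, h.msg,
      by simpa [Function.comp_def] using h.acc⟩
  · rintro ⟨s, hs, h⟩
    exact ⟨fun e => (s e).1.1, fun e => (s e).2.trans (congrArg g (hs e)), h.node, h.first, h.edge, h.int, h.msg,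
      by simpa [Function.comp_def] using h.acc⟩

theorem top [Finite L] : Recog (P := P) (A := A) (fun M (_ : M.E → L) => True) :=
  (node (fun _ _ (_ : L) => True)).congr fun _ _ => by simp

theorem all [Finite L] {ι : Type} [Finite ι] {Φ : ι → ∀ M : MSC P A, (M.E → L) → Prop}
    (h : ∀ i, Recog (Φ i)) : Recog (fun M ℓ => ∀ i, Φ i M ℓ) := by
  classical
  have := Fintype.ofFinite ι
  have key : ∀ s : Finset ι, Recog (fun M ℓ => ∀ i ∈ s, Φ i M ℓ) := by
    intro s
    induction s using Finset.induction_on with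
    | empty => exact top.congr fun _ _ => by simp
    | insert i s _ ih => exact ((h i).and ih).congr fun _ _ => by simp
  exact (key Finset.univ).congr fun _ _ => by simp

end Recog

/-! ### Recognizable operators and sets of events -/

/-- An operator on labellings is recognizable if its graph is. -/
def RecOp {L K : Type} (T : ∀ M : MSC P A, (M.E → L) → M.E → K) : Prop :=
  Recog fun M (ℓ : M.E → L × K) => ∀ e, (ℓ e).2 = T M (fun x => (ℓ x).1) e

/-- A unary family of events is recognizable if the labelling by membership is. -/
def Rec (X : ∀ M : MSC P A, M.E → Prop) : Prop :=
  RecOp fun M (_ : M.E → Unit) => X M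

section RecOp

variable {L K C : Type}

theorem RecOp.congr {T T' : ∀ M : MSC P A, (M.E → L) → M.E → K} (h : RecOp T)
    (hT : ∀ M ℓ e, T' M ℓ e = T M ℓ e) : RecOp T' := by
  have : T' = T := by
    funext M ℓ e
    exact hT M ℓ e
  exact this ▸ h

/-- Substitution of recognizable operators into recognizable properties. -/
theorem Recog.subst [Finite L] [Finite K] {Φ : ∀ M : MSC P A, (M.E → L × K) → Prop} (h : Recog Φ)
    {T : ∀ M : MSC P A, (M.E → L) → M.E → K} (hT : RecOp T) :
    Recog (fun M ℓ => Φ M fun e => (ℓ e, T M ℓ e)) := by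
  refine (h.and hT).ex.congr fun M ℓ => ?_
  constructor
  · intro h
    exact ⟨T M ℓ, h, fun _ => rfl⟩
  · rintro ⟨κ, h, hκ⟩
    obtain rfl : κ = T M ℓ := funext hκ
    exact h

theorem Rec.const [Finite L] {X : ∀ M : MSC P A, M.E → Prop} (hX : Rec X) :
    RecOp (fun M (_ : M.E → L) => X M) :=
  hX.comap (K := L × Prop) fun x => ((), x.2)

variable [Finite L] [Finite K] [Finite C]

theorem RecOp.pointwise (g : P → A → L → K) :
    RecOp (P := P) (A := A) (fun M ℓ e => g (M.loc e) (M.lab e) (ℓ e)) :=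
  Recog.node fun p a (x : L × K) => x.2 = g p a x.1

theorem RecOp.comp {T : ∀ M : MSC P A, (M.E → L) → M.E → K} (hT : RecOp T)
    {T' : ∀ M : MSC P A, (M.E → K) → M.E → C} (hT' : RecOp T') :
    RecOp (fun M ℓ => T' M (T M ℓ)) := by
  have h1 := hT'.comap (K := (L × C) × K) (fun x => (x.2, x.1.2))
  have h2 : RecOp (P := P) (A := A) (L := L × C) (fun M ℓ => T M fun x => (ℓ x).1) :=
    hT.comap (K := (L × C) × K) (fun x => (x.1.1, x.2))
  exact h1.subst h2

theorem RecOp.prod {T : ∀ M : MSC P A, (M.E → L) → M.E → K} (hT : RecOp T)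
    {T' : ∀ M : MSC P A, (M.E → L) → M.E → C} (hT' : RecOp T') :
    RecOp (fun M ℓ e => (T M ℓ e, T' M ℓ e)) := by
  have h1 := hT.comap (K := L × (K × C)) (fun x => (x.1, x.2.1))
  have h2 := hT'.comap (K := L × (K × C)) (fun x => (x.1, x.2.2))
  refine (h1.and h2).congr fun M ℓ => ?_
  simp [Prod.ext_iff, forall_and]

theorem RecOp.map {T : ∀ M : MSC P A, (M.E → L) → M.E → K} (hT : RecOp T) (g : K → C) :
    RecOp (fun M ℓ e => g (T M ℓ e)) :=
  hT.comp (RecOp.pointwise fun _ _ => g)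

theorem RecOp.map₂ {D : Type} [Finite D] {T : ∀ M : MSC P A, (M.E → L) → M.E → K} (hT : RecOp T)
    {T' : ∀ M : MSC P A, (M.E → L) → M.E → C} (hT' : RecOp T') (g : K → C → D) :
    RecOp (fun M ℓ e => g (T M ℓ e) (T' M ℓ e)) :=
  (hT.prod hT').map fun x => g x.1 x.2

theorem Rec.congr {X Y : ∀ M : MSC P A, M.E → Prop} (hX : Rec X)
    (h : ∀ M e, Y M e ↔ X M e) : Rec Y :=
  RecOp.congr hX fun M _ e => propext (h M e)

/-- A witness for `Rec` computes the truth value at every event, so complementation acts on the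
output label and not on the recognizing system. -/
theorem Rec.not {X : ∀ M : MSC P A, M.E → Prop} (hX : Rec X) : Rec fun M e => ¬ X M e :=
  RecOp.map hX Not

theorem Rec.and {X Y : ∀ M : MSC P A, M.E → Prop} (hX : Rec X) (hY : Rec Y) :
    Rec fun M e => X M e ∧ Y M e :=
  RecOp.map₂ hX hY And

theorem Rec.or {X Y : ∀ M : MSC P A, M.E → Prop} (hX : Rec X) (hY : Rec Y) :
    Rec fun M e => X M e ∨ Y M e :=
  RecOp.map₂ hX hY Or

theorem Rec.node (φ : P → A → Prop) : Rec fun M (e : M.E) => φ (M.loc e) (M.lab e) :=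
  RecOp.pointwise fun p a _ => φ p a

theorem Rec.top : Rec (P := P) (A := A) fun _ _ => True :=
  Rec.node fun _ _ => True

theorem Rec.bot : Rec (P := P) (A := A) fun _ _ => False :=
  Rec.node fun _ _ => False

theorem RecOp.apply {T : ∀ M : MSC P A, (M.E → Prop) → M.E → Prop} (hT : RecOp T)
    {X : ∀ M : MSC P A, M.E → Prop} (hX : Rec X) : Rec fun M => T M (X M) :=
  RecOp.comp hX hT

end RecOp

/-! ### From local systems to CFMs -/

/-- A recognizable property of unlabelled MSCs is recognized by a CFM. -/
theorem Recog.cfm {Φ : ∀ M : MSC P A, (M.E → Unit) → Prop} (h : Recog Φ) :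
    ∃ C : CFM P A, ∀ M, M ∈ C.language ↔ Φ M fun _ => () := by
  obtain ⟨S, hS, π, Γ, hΓ⟩ := h
  refine ⟨{
    -- A message carries the labels of both of its ends: the sender guesses the label of the receive
    -- event, and the receiver checks the guess. A state is the label of the latest event, and
    -- `none` before the first one.
    Msg := S × S
    finite_Msg := inferInstance
    S := fun _ => Option S
    finite_S := fun _ => inferInstance
    init := fun _ => none
    trans := fun p => {x | ∃ s, x.2.2 = some s ∧ Γ.node p x.2.1.label s ∧
      (x.1 = none → Γ.first s) ∧ (∀ s', x.1 = some s' → Γ.edge s' s) ∧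
      (x.2.1.IsInternal → Γ.int s) ∧
      (∀ m q, x.2.1.IsSend m q → m.1 = s ∧ Γ.msg p s q m.2) ∧
      (∀ m q, x.2.1.IsReceive m q → m.2 = s)}
    Acc := {t | Γ.acc t} }, fun M => ?_⟩
  rw [hΓ]
  constructor
  · rintro ⟨ρ, t, ht, hl⟩
    choose s hs hnode hfirst hedge hint hsend hrec using
      fun e : M.E => ρ.mem_trans (M.loc e) ⟨e, rfl⟩
    have key : ∀ p (x : M.On p), ρ.target p x = some (s x.1) := by
      rintro _ ⟨x, rfl⟩
      exact hs x
    refine ⟨s, fun _ => rfl, ?_, ?_, ?_, ?_, ?_, ?_⟩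
    · intro e
      have := hnode e
      rwa [ρ.label_eq] at this
    · intro e he
      exact hfirst e (ρ.source_init _ _ he)
    · intro e f hef
      have h1 := ρ.target_source (M.loc f) ⟨e, M.next_loc _ _ hef⟩ ⟨f, rfl⟩ hef
      rw [key] at h1
      exact hedge f _ h1.symm
    · intro e he
      exact hint e (ρ.internal _ _ he)
    · intro e f hef
      obtain ⟨m, h1, h2⟩ := ρ.message (M.loc e) (M.loc f) ⟨e, rfl⟩ ⟨f, rfl⟩ hef
      have h3 := hsend e m _ h1
      have h4 := hrec f m _ h2
      rw [← h4]
      exact h3.2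
    · have ht' : Γ.acc t := ht
      convert ht' using 1
      funext p
      rcases hl p with ⟨e, he, h1⟩ | ⟨h0, h1⟩
      · have : M.lastEv p = some e.1 :=
          MSC.lastEv_eq_some.2 ⟨e.2, fun f hf => he ⟨f, hf⟩⟩
        rw [this, h1, key]
        rfl
      · rw [MSC.lastEv_eq_none.2 h0, h1]
        rfl
  · rintro ⟨s, -, h⟩
    classical
    let src : M.E → Option S := fun e => if h : ∃ f, M.next f e then some (s h.choose) else none
    have hsrc : ∀ e f, M.next e f → src f = some (s e) := by
      intro e f hef
      have h1 : ∃ x, M.next x f := ⟨e, hef⟩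
      have h2 : h1.choose = e :=
        MSC.nx_unique_left (d := true) (e := f) (h1.choose_spec : M.nx true _ _) hef
      simp only [src, dif_pos h1, h2]
    have hact : ∀ e : M.E, ∃ α : CFMAction A (S × S) (M.loc e), α.label = M.lab e ∧
        (M.IsInternal e ↔ α.IsInternal) ∧
        (∀ m q, α.IsSend m q ↔ ∃ f, M.msg e f ∧ M.loc f = q ∧ m = (s e, s f)) ∧
        (∀ m q, α.IsReceive m q ↔ ∃ f, M.msg f e ∧ M.loc f = q ∧ m = (s f, s e)) := by
      intro e
      by_cases h1 : ∃ f, M.msg e f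
      · obtain ⟨f, hf⟩ := h1
        have hu : ∀ g, M.msg e g → g = f := fun g hg =>
          (M.msg_unique _ _ _ _ hg hf (Or.inl rfl)).2
        have hn : ∀ g, ¬ M.msg g e := fun g hg => by
          obtain ⟨rfl, rfl⟩ := M.msg_unique _ _ _ _ hg hf (Or.inr (Or.inr (Or.inl rfl)))
          exact M.msg_loc _ _ hg rfl
        refine ⟨.send (M.lab e) (s e, s f) (M.loc f) (M.msg_loc _ _ hf).symm, rfl, ?_, ?_, ?_⟩
        · simp only [CFMAction.IsInternal, reduceCtorEq, exists_false, iff_false]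
          exact fun hi => (hi f).1 hf
        · intro m q
          simp only [CFMAction.IsSend, CFMAction.send.injEq]
          constructor
          · rintro ⟨_, _, -, rfl, rfl⟩
            exact ⟨f, hf, rfl, rfl⟩
          · rintro ⟨g, hg, rfl, rfl⟩
            obtain rfl := hu g hg
            exact ⟨_, (M.msg_loc _ _ hf).symm, rfl, rfl, rfl⟩
        · intro m q
          simp [CFMAction.IsReceive, hn]
      · by_cases h2 : ∃ f, M.msg f e
        · obtain ⟨f, hf⟩ := h2
          have hu : ∀ g, M.msg g e → g = f := fun g hg =>
            (M.msg_unique _ _ _ _ hg hf (Or.inr (Or.inr (Or.inr rfl)))).1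
          refine ⟨.receive (M.lab e) (s f, s e) (M.loc f) (M.msg_loc _ _ hf), rfl, ?_, ?_, ?_⟩
          · simp only [CFMAction.IsInternal, reduceCtorEq, exists_false, iff_false]
            exact fun hi => (hi f).2 hf
          · intro m q
            push Not at h1
            simp [CFMAction.IsSend, h1]
          · intro m q
            simp only [CFMAction.IsReceive, CFMAction.receive.injEq]
            constructor
            · rintro ⟨_, _, -, rfl, rfl⟩
              exact ⟨f, hf, rfl, rfl⟩
            · rintro ⟨g, hg, rfl, rfl⟩
              obtain rfl := hu g hg
              exact ⟨_, M.msg_loc _ _ hf, rfl, rfl, rfl⟩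
        · push Not at h1 h2
          refine ⟨.internal (M.lab e), rfl, ?_, ?_, ?_⟩
          · simp [CFMAction.IsInternal, MSC.IsInternal, h1, h2]
          · simp [CFMAction.IsSend, h1]
          · simp [CFMAction.IsReceive, h2]
    choose α hlab hint hsend hrec using hact
    let act : ∀ p, M.On p → CFMAction A (S × S) p := fun p e => e.2 ▸ α e.1
    refine ⟨{
      source := fun p e => src e.1
      act := act
      target := fun p e => some (s e.1)
      mem_trans := ?_
      label_eq := ?_
      source_init := ?_
      target_source := ?_
      internal := ?_
      message := ?_ }, fun p => (M.lastEv p).map s, h.acc, ?_⟩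
    · rintro _ ⟨e, rfl⟩
      refine ⟨s e, rfl, ?_, ?_, ?_, ?_, ?_, ?_⟩
      · have := h.node e
        rwa [← hlab] at this
      · intro h0
        refine h.first e fun f hf => ?_
        have := hsrc f e hf
        simp_all
      · intro s' hs'
        simp only [src] at hs'
        split_ifs at hs' with h0
        cases hs'
        exact h.edge _ _ h0.choose_spec
      · exact fun hi => h.int e ((hint e).2 hi)
      · intro m q hm
        obtain ⟨f, hf, rfl, rfl⟩ := (hsend e m q).1 hm
        exact ⟨rfl, h.msg _ _ hf⟩
      · intro m q hm
        obtain ⟨f, hf, rfl, rfl⟩ := (hrec e m q).1 hm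
        rfl
    · rintro _ ⟨e, rfl⟩
      exact hlab e
    · rintro _ ⟨e, rfl⟩ he
      have : ¬ ∃ f, M.next f e := by simpa using he
      simp [src, this]
    · rintro p e f hef
      exact (hsrc _ _ hef).symm
    · rintro _ ⟨e, rfl⟩ he
      exact (hint e).1 he
    · rintro _ _ ⟨e, rfl⟩ ⟨f, rfl⟩ hef
      exact ⟨(s e, s f), (hsend e _ _).2 ⟨f, hef, rfl, rfl⟩, (hrec f _ _).2 ⟨e, hef, rfl, rfl⟩⟩
    · intro p
      rcases hl : M.lastEv p with _ | e
      · exact Or.inr ⟨MSC.lastEv_eq_none.1 hl, by simp [hl]⟩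
      · have h1 := MSC.lastEv_eq_some.1 hl
        exact Or.inl ⟨⟨e, h1.1⟩, fun f => h1.2 f.1 f.2, by simp [hl]⟩

/-! ### Block decompositions for monotone functions on a chain -/

/-- Greedy decomposition of `ℕ` into blocks for a monotone function `F`: the pair of the start of
the current block and of its number. -/
noncomputable def greedyBlock (F : ℕ → ℕ) : ℕ → ℕ × ℤ
  | 0 => (0, 0)
  | k + 1 =>
    open Classical in
    if ∃ y, (greedyBlock F k).1 ≤ y ∧ y ≤ k + 1 ∧ (greedyBlock F k).1 ≤ F y ∧ F y ≤ k + 1 ∧ F y ≠ y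
    then (k + 1, (greedyBlock F k).2 + 1) else greedyBlock F k

/-- A new block is opened exactly when the next point would put some non-fixed point and its image
into the same block. So no block contains such a pair, and block numbers grow at each opening. -/
theorem greedyBlock_spec (F : ℕ → ℕ) (k : ℕ) : (greedyBlock F k).1 ≤ k ∧
    (∀ x, (greedyBlock F k).1 ≤ x → x ≤ k → (greedyBlock F x).2 = (greedyBlock F k).2) ∧
    (∀ x, x < (greedyBlock F k).1 → (greedyBlock F x).2 < (greedyBlock F k).2) ∧
    (∀ y, (greedyBlock F k).1 ≤ y → y ≤ k → (greedyBlock F k).1 ≤ F y → F y ≤ k → F y = y) := by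
  induction k with
  | zero =>
    refine ⟨le_rfl, fun x _ hx => ?_, fun x hx => absurd hx (Nat.not_lt_zero _), ?_⟩
    · obtain rfl : x = 0 := by omega
      rfl
    · intro y _ hy _ hFy
      omega
  | succ k ih =>
    obtain ⟨h1, h2, h3, h4⟩ := ih
    by_cases h : ∃ y, (greedyBlock F k).1 ≤ y ∧ y ≤ k + 1 ∧ (greedyBlock F k).1 ≤ F y ∧
      F y ≤ k + 1 ∧ F y ≠ y
    · have hg : greedyBlock F (k + 1) = (k + 1, (greedyBlock F k).2 + 1) := by
        rw [greedyBlock, if_pos h]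
      rw [hg]
      refine ⟨le_rfl, fun x hx hx' => ?_, fun x hx => ?_, fun y _ _ _ _ => by dsimp at *; omega⟩
      · obtain rfl : x = k + 1 := le_antisymm hx' hx
        rw [hg]
      · rcases lt_or_ge x (greedyBlock F k).1 with h5 | h5
        · have := h3 x h5
          dsimp
          omega
        · have := h2 x h5 (Nat.lt_succ_iff.1 hx)
          dsimp
          omega
    · have hg : greedyBlock F (k + 1) = greedyBlock F k := by rw [greedyBlock, if_neg h]
      rw [hg]
      refine ⟨by omega, fun x hx hx' => ?_, h3, fun y hy hy' hF hF' => ?_⟩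
      · rcases Nat.lt_or_ge k x with h5 | h5
        · obtain rfl : x = k + 1 := by omega
          rw [hg]
        · exact h2 x hx h5
      · by_contra hne
        exact h ⟨y, hy, hy', hF, hF', hne⟩

/-- A monotone function admits a block decomposition in which every point that is not fixed is
moved by one or two blocks. -/
theorem exists_blocks {F : ℕ → ℕ} (hF : Monotone F) : ∃ B : ℕ → ℤ,
    (∀ i, B (i + 1) = B i ∨ B (i + 1) = B i + 1) ∧
    ∀ i, -2 ≤ B (F i) - B i ∧ B (F i) - B i ≤ 2 ∧ (i < F i ↔ 0 < B (F i) - B i) ∧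
      (F i < i ↔ B (F i) - B i < 0) := by
  set B : ℕ → ℤ := fun k => (greedyBlock F k).2 with hB
  have step : ∀ i, B (i + 1) = B i ∨ (B (i + 1) = B i + 1 ∧
      ∃ y, B i ≤ B y ∧ B i ≤ B (F y) ∧ y ≤ i + 1 ∧ F y ≤ i + 1 ∧ F y ≠ y) := by
    intro i
    by_cases h : ∃ y, (greedyBlock F i).1 ≤ y ∧ y ≤ i + 1 ∧ (greedyBlock F i).1 ≤ F y ∧
      F y ≤ i + 1 ∧ F y ≠ y
    · right
      have h1 : B (i + 1) = B i + 1 := by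
        simp only [hB]
        rw [greedyBlock, if_pos h]
      refine ⟨h1, ?_⟩
      have key : ∀ x, (greedyBlock F i).1 ≤ x → x ≤ i + 1 → B i ≤ B x := by
        intro x hx hx'
        rcases Nat.lt_or_ge i x with h5 | h5
        · obtain rfl : x = i + 1 := by omega
          omega
        · exact ((greedyBlock_spec F i).2.1 x hx h5).ge
      obtain ⟨y, h2, h3, h4, h5, h6⟩ := h
      exact ⟨y, key y h2 h3, key _ h4 h5, h3, h5, h6⟩
    · left
      simp only [hB]
      rw [greedyBlock, if_neg h]
  have mono : Monotone B := monotone_nat_of_le_succ fun i => by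
    rcases step i with h | h <;> omega
  have ivt : ∀ (j : ℤ) (x z : ℕ), x ≤ z → B x ≤ j → j < B z → ∃ k, B k = j ∧ B (k + 1) = j + 1 := by
    intro j x z hxz hx hz
    induction z, hxz using Nat.le_induction with
    | base => omega
    | succ z hz' ih =>
      rcases lt_or_ge j (B z) with h | h
      · exact ih h
      · refine ⟨z, ?_⟩
        rcases step z with h1 | h1 <;> omega
  have strict : ∀ x z, x ≤ z → B x = B z → (greedyBlock F z).1 ≤ x := by
    intro x z _ hb
    by_contra hc
    have := (greedyBlock_spec F z).2.2.1 x (by omega)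
    simp only [hB] at hb
    omega
  have up : ∀ i, i < F i → B i < B (F i) := by
    intro i hi
    refine lt_of_le_of_ne (mono hi.le) fun h => ?_
    have := (greedyBlock_spec F (F i)).2.2.2 i (strict _ _ hi.le h) hi.le
      (greedyBlock_spec F (F i)).1 le_rfl
    omega
  have down : ∀ i, F i < i → B (F i) < B i := by
    intro i hi
    refine lt_of_le_of_ne (mono hi.le) fun h => ?_
    have := (greedyBlock_spec F i).2.2.2 i (greedyBlock_spec F i).1 le_rfl
      (strict _ _ hi.le h) hi.le
    omega
  refine ⟨B, fun i => (step i).imp id And.left, fun i => ⟨?_, ?_, ?_, ?_⟩⟩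
  -- Suppose that `F i` lies three or more blocks before `i`. The witness `y` for closing the block
  -- after that of `F i` lies at or before `i`, so `F y ≤ F i`. But the block of `F y` comes after
  -- that of `F i`. The upper bound is symmetric.
  · by_contra hc
    have hlt : F i < i := by
      by_contra h
      have := mono (not_lt.1 h)
      omega
    obtain ⟨k, hk, hk'⟩ := ivt (B (F i) + 1) (F i) i hlt.le (by omega) (by omega)
    rcases step k with h | ⟨-, y, h1, h2, h3, h4, -⟩
    · omega
    · have h5 := mono h3
      have h6 : y ≤ i := by
        by_contra h
        have := mono (not_le.1 h).le
        omega
      have := mono (hF h6)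
      omega
  · by_contra hc
    have hlt : i < F i := by
      by_contra h
      have := mono (not_lt.1 h)
      omega
    obtain ⟨k, hk, hk'⟩ := ivt (B i + 1) i (F i) hlt.le (by omega) (by omega)
    rcases step k with h | ⟨-, y, h1, h2, h3, h4, -⟩
    · omega
    · have h5 := mono h4
      have h6 : i ≤ y := by
        by_contra h
        have := mono (not_le.1 h).le
        omega
      have := mono (hF h6)
      omega
  · refine ⟨fun h => by have := up i h; omega, fun h => ?_⟩
    by_contra h'
    have := mono (not_lt.1 h')
    omega
  · refine ⟨fun h => by have := down i h; omega, fun h => ?_⟩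
    by_contra h'
    have := mono (not_lt.1 h')
    omega

/-- Block numbers modulo 6 suffice to find the direction in which a monotone function of a finite
chain to itself moves a point. -/
theorem blocks_sound {n : ℕ} {F : ℕ → ℕ} (hF : Monotone F) (hn : ∀ i < n, F i < n)
    {β : ℕ → ZMod 6} (step : ∀ i, i + 1 < n → β (i + 1) = β i ∨ β (i + 1) = β i + 1)
    {δ : ℕ → ℤ} (hδ : ∀ i < n, -2 ≤ δ i ∧ δ i ≤ 2 ∧ β (F i) = β i + δ i) :
    ∀ i < n, (0 < δ i → i < F i) ∧ (δ i < 0 → F i < i) := by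
  classical
  -- The integer lift of `β`, obtained by adding up its steps.
  let B : ℕ → ℤ := fun k => Nat.rec 0 (fun k b => b + if β (k + 1) = β k then 0 else 1) k
  have hB : ∀ k, B (k + 1) = B k + if β (k + 1) = β k then 0 else 1 := fun _ => rfl
  have hB' : ∀ k, B k ≤ B (k + 1) ∧ B (k + 1) ≤ B k + 1 := by
    intro k
    rw [hB]
    split_ifs <;> omega
  have mono : Monotone B := monotone_nat_of_le_succ fun i => (hB' i).1
  have hβ : ∀ i < n, Int.cast (B i) = β i - β 0 := by
    intro i
    induction i with
    | zero => intro _; simp [B]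
    | succ i ih =>
      intro hi
      rw [hB, Int.cast_add, ih (by omega)]
      split_ifs with h
      · simp [h]
      · rw [(step i hi).resolve_left h]
        push_cast
        ring
  have hk : ∀ i < n, ∃ k : ℤ, B (F i) - B i = δ i + 6 * k := by
    intro i hi
    have h1 : ((B (F i) - B i - δ i : ℤ) : ZMod 6) = 0 := by
      push_cast
      rw [hβ _ (hn i hi), hβ i hi, (hδ i hi).2.2]
      ring
    obtain ⟨k, hk⟩ := (ZMod.intCast_zmod_eq_zero_iff_dvd _ 6).1 h1
    push_cast at hk
    exact ⟨k, by omega⟩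
  -- The displacement `B (F i) - B i` is congruent to `δ i` modulo 6, so it is never 3 modulo 6:
  -- this is why modulus 6 is used for five values of `δ`. It starts nonnegative and falls by at
  -- most one per step, hence cannot pass −3. Backwards from the last point, it likewise cannot pass
  -- 3. Between these bounds it must equal `δ i`.
  have lower : ∀ i < n, -3 ≤ B (F i) - B i := by
    intro i
    induction i with
    | zero =>
      intro _
      have := mono (Nat.zero_le (F 0))
      omega
    | succ i ih =>
      intro hi
      have h1 := ih (by omega)
      obtain ⟨k, hk⟩ := hk i (by omega)
      have h2 := hδ i (by omega)
      have h3 := mono (hF (Nat.le_succ i))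
      have h4 := hB' i
      simp only [Nat.succ_eq_add_one] at h3
      omega
  have upper : ∀ j i, i + j + 1 = n → B (F i) - B i ≤ 3 := by
    intro j
    induction j with
    | zero =>
      intro i hi
      have := mono (show F i ≤ i by have := hn i (by omega); omega)
      omega
    | succ j ih =>
      intro i hi
      have h1 := ih (i + 1) (by omega)
      obtain ⟨k, hk⟩ := hk (i + 1) (by omega)
      have h2 := hδ (i + 1) (by omega)
      have h3 := mono (hF (Nat.le_succ i))
      have h4 := hB' i
      simp only [Nat.succ_eq_add_one] at h3
      omega
  intro i hi
  have h1 := lower i hi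
  have h2 := upper (n - 1 - i) i (by omega)
  obtain ⟨k, hk⟩ := hk i hi
  have h3 := hδ i hi
  constructor
  · intro h
    by_contra hc
    have := mono (not_lt.1 hc)
    omega
  · intro h
    by_contra hc
    have := mono (not_lt.1 hc)
    omega

/-! ### Certificates for the movement of events under monotone functions -/

namespace MSC

variable {M : MSC P A}

/-- The function maps every process to itself, and is monotone there. -/
structure Mono (d : Bool) (F : M.E → M.E) : Prop where
  loc : ∀ e, M.loc (F e) = M.loc e
  mono : ∀ e f, M.ord d e f → M.ord d (F e) (F f)

theorem Mono.exists_nat {d : Bool} {F : M.E → M.E} (hF : Mono d F) (p : P) :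
    ∃ G : ℕ → ℕ, Monotone G ∧ (∀ i < M.cnt d p, G i < M.cnt d p) ∧
      ∀ e, M.loc e = p → M.pos d (F e) = G (M.pos d e) := by
  have := M.nonempty_E
  choose! ev hloc hpos using fun k (hk : k < M.cnt d p) => exists_pos hk
  have hG : ∀ i < M.cnt d p, M.pos d (F (ev i)) < M.cnt d p := by
    intro i hi
    have := pos_lt_cnt d (F (ev i))
    rwa [hF.loc, hloc i hi] at this
  -- Beyond the chain the identity keeps the function monotone, since the chain is mapped into
  -- itself.
  refine ⟨fun i => if i < M.cnt d p then M.pos d (F (ev i)) else i, ?_, ?_, ?_⟩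
  · intro i j hij
    dsimp only
    split_ifs with h1 h2 h3
    · exact (hF.mono _ _ ⟨(hloc i h1).trans (hloc j h2).symm, by rwa [hpos i h1, hpos j h2]⟩).2
    · have := hG i h1
      omega
    · omega
    · omega
  · intro i hi
    simpa [hi] using hG i hi
  · rintro e rfl
    have h1 := pos_lt_cnt d e
    have h2 : ev (M.pos d e) = e := pos_inj (d := d) (hloc _ h1) (hpos _ h1)
    simp [h1, h2]

/-- The labels `(u e, w e)` certify that `F e` lies after, or before, `e`. -/
def Cert (M : MSC P A) (d : Bool) (F : M.E → M.E) (ℓ : M.E → Prop × Prop) : Prop :=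
  ∃ β : M.E → ZMod 6, (∀ e f, M.nx d e f → β f = β e ∨ β f = β e + 1) ∧
    ∀ e, ∃ δ : ℤ, -2 ≤ δ ∧ δ ≤ 2 ∧ β (F e) = β e + δ ∧ ((ℓ e).1 ↔ 0 < δ) ∧ ((ℓ e).2 ↔ δ < 0)

/-- Only claims of movement are guaranteed. Where both labels are false nothing follows: `δ = 0`
does not force `F e = e`. -/
theorem Cert.sound {d : Bool} {F : M.E → M.E} (hF : Mono d F) {ℓ : M.E → Prop × Prop}
    (h : M.Cert d F ℓ) (e : M.E) :
    ((ℓ e).1 → M.lt d e (F e)) ∧ ((ℓ e).2 → M.lt d (F e) e) := by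
  obtain ⟨β, hβ, hδ⟩ := h
  choose δ h1 h2 h3 h4 h5 using hδ
  obtain ⟨G, hG, hn, hFG⟩ := hF.exists_nat (M.loc e)
  have := M.nonempty_E
  choose! ev hloc hpos using fun k (hk : k < M.cnt d (M.loc e)) => exists_pos hk
  have hev : ∀ f, M.loc f = M.loc e → ev (M.pos d f) = f := by
    intro f hf
    have h1 := pos_lt_cnt d f
    rw [hf] at h1
    exact pos_inj (d := d) ((hloc _ h1).trans hf.symm) (hpos _ h1)
  have key := blocks_sound hG hn (β := fun i => β (ev i)) (δ := fun i => δ (ev i)) ?_ ?_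
    (M.pos d e) (pos_lt_cnt d e)
  · rw [hev e rfl, ← hFG e rfl] at key
    exact ⟨fun h => ⟨(hF.loc e).symm, key.1 ((h4 e).1 h)⟩,
      fun h => ⟨hF.loc e, key.2 ((h5 e).1 h)⟩⟩
  · intro i hi
    refine hβ _ _ (nx_iff.2 ⟨(hloc i (by omega)).trans (hloc _ hi).symm, ?_⟩)
    rw [hpos i (by omega), hpos _ hi]
  · intro i hi
    refine ⟨h1 _, h2 _, ?_⟩
    have h6 := hFG (ev i) (hloc i hi)
    rw [hpos i hi] at h6
    rw [← h3, ← h6, hev _ ((hF.loc _).trans (hloc i hi))]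

theorem Cert.complete {d : Bool} {F : M.E → M.E} (hF : Mono d F) :
    M.Cert d F fun e => (M.lt d e (F e), M.lt d (F e) e) := by
  choose G hG _ hFG using fun p => hF.exists_nat p
  choose B hB hB' using fun p => exists_blocks (hG p)
  refine ⟨fun e => (B (M.loc e) (M.pos d e) : ℤ), fun e f hef => ?_, fun e => ?_⟩
  · have h1 := nx_iff.1 hef
    dsimp only
    rw [← h1.1, ← h1.2]
    rcases hB (M.loc e) (M.pos d e) with h | h <;> simp [h]
  · obtain ⟨h1, h2, h3, h4⟩ := hB' (M.loc e) (M.pos d e)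
    refine ⟨_, h1, h2, ?_, ?_, ?_⟩
    · dsimp only
      rw [hF.loc, hFG _ e rfl]
      push_cast
      ring
    · rw [← h3, ← hFG _ e rfl]
      simp [lt, hF.loc]
    · rw [← h4, ← hFG _ e rfl]
      simp [lt, hF.loc]

open Classical in
/-- The predecessor of an event in the direction `d`; the first event is its own predecessor. -/
noncomputable def pred (M : MSC P A) (d : Bool) (e : M.E) : M.E :=
  if h : ∃ f, M.nx d f e then h.choose else e

theorem pred_eq {d : Bool} {e f : M.E} (h : M.nx d f e) : M.pred d e = f := by
  have h1 : ∃ f, M.nx d f e := ⟨f, h⟩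
  rw [pred, dif_pos h1]
  exact nx_unique_left h1.choose_spec h

theorem pred_first {d : Bool} {e : M.E} (h : ∀ f, ¬ M.nx d f e) : M.pred d e = e := by
  rw [pred, dif_neg (by simpa using h)]

theorem loc_pred (d : Bool) (e : M.E) : M.loc (M.pred d e) = M.loc e := by
  by_cases h : ∃ f, M.nx d f e
  · obtain ⟨f, hf⟩ := h
    rw [pred_eq hf, nx_loc hf]
  · rw [pred_first (by simpa using h)]

theorem pos_pred (d : Bool) (e : M.E) : M.pos d (M.pred d e) = M.pos d e - 1 := by
  by_cases h : ∃ f, M.nx d f e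
  · obtain ⟨f, hf⟩ := h
    rw [pred_eq hf, ← (nx_iff.1 hf).2]
    rfl
  · have h0 : M.pos d e = 0 := by
      by_contra hc
      have h1 := pos_lt_cnt d e
      obtain ⟨f, hf, hp⟩ := exists_pos (M := M) (d := d) (p := M.loc e) (k := M.pos d e - 1)
        (by omega)
      exact h ⟨f, nx_iff.2 ⟨hf, by omega⟩⟩
    rw [pred_first (by simpa using h)]
    omega

theorem Mono.pred {d : Bool} {F : M.E → M.E} (hF : Mono d F) : Mono d fun e => M.pred d (F e) where
  loc e := by rw [loc_pred, hF.loc]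
  mono e f h := by
    have := hF.mono e f h
    refine ⟨by rw [loc_pred, loc_pred, this.1], ?_⟩
    rw [pos_pred, pos_pred]
    exact Nat.sub_le_sub_right this.2 1

end MSC

section

theorem Rec.isLast (d : Bool) : Rec (P := P) (A := A) fun M e => ∀ f, ¬ M.nx d e f := by
  have h1 := Recog.last (P := P) (A := A) d (fun x : Unit × Prop => x.2)
  have h2 := Recog.edge (P := P) (A := A) d (fun x _ : Unit × Prop => ¬ x.2)
  refine (h1.and h2).congr fun M ℓ => ?_
  constructor
  · intro h
    exact ⟨fun e he => (h e).mpr he, fun e f hef he => ((h e).mp he) f hef⟩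
  · rintro ⟨h, h'⟩ e
    exact propext ⟨fun he f hf => h' e f hf he, h e⟩

theorem RecOp.pred {K : Type} [Finite K] (d : Bool) :
    RecOp (P := P) (A := A) fun M (ℓ : M.E → K) e => ℓ (M.pred d e) := by
  have h1 := Recog.last (P := P) (A := A) (!d) (fun x : K × K => x.2 = x.1)
  have h2 := Recog.edge (P := P) (A := A) d (fun x y : K × K => y.2 = x.1)
  refine (h1.and h2).congr fun M ℓ => ?_
  simp only [MSC.nx_not]
  constructor
  · intro h
    exact ⟨fun e he => by rw [h, MSC.pred_first he], fun e f hef => by rw [h, MSC.pred_eq hef]⟩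
  · rintro ⟨h, h'⟩ e
    by_cases he : ∃ f, M.nx d f e
    · obtain ⟨f, hf⟩ := he
      rw [MSC.pred_eq hf, h' f e hf]
    · have he' : ∀ f, ¬ M.nx d f e := by simpa using he
      rw [MSC.pred_first he', h e he']

/-- The colouring `β` is guessed. The colour at `F M e` is made available at `e` by `hop`, after
which every condition is local. -/
theorem Recog.cert {d : Bool} {F : ∀ M : MSC P A, M.E → M.E}
    (hop : RecOp fun M (ℓ : M.E → ZMod 6) e => ℓ (F M e)) :
    Recog fun M (ℓ : M.E → Prop × Prop) => M.Cert d (F M) ℓ := by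
  have : Finite (ZMod 6) := inferInstanceAs (Finite (Fin 6))
  have h1 := Recog.edge (P := P) (A := A) d
    (fun x y : (Prop × Prop) × ZMod 6 => y.2 = x.2 ∨ y.2 = x.2 + 1)
  have h2 := (Recog.node (P := P) (A := A) (fun _ _ (x : ((Prop × Prop) × ZMod 6) × ZMod 6) =>
    ∃ δ : ℤ, -2 ≤ δ ∧ δ ≤ 2 ∧ x.2 = x.1.2 + δ ∧ (x.1.1.1 ↔ 0 < δ) ∧ (x.1.1.2 ↔ δ < 0))).subst
    (RecOp.comp (RecOp.pointwise fun _ _ (x : (Prop × Prop) × ZMod 6) => x.2) hop)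
  exact (h1.and h2).ex

/-- It is recognizable whether a monotone function moves an event forwards. -/
theorem Rec.lt_apply {d : Bool} {F : ∀ M : MSC P A, M.E → M.E} (hF : ∀ M, MSC.Mono d (F M))
    (hop : ∀ (K : Type) [Finite K], RecOp fun M (ℓ : M.E → K) e => ℓ (F M e)) :
    Rec fun M e => M.lt d e (F M e) := by
  have : Finite (ZMod 6) := inferInstanceAs (Finite (Fin 6))
  have h1 := (Recog.cert (d := d) (hop (ZMod 6))).comap
    (K := ((Unit × Prop) × (Prop × Prop)) × (Prop × Prop)) (fun x => x.1.2)
  -- Certificates establish strict movement only. That `F M e` is not after `e` is rephrased as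
  -- strict movement backwards: the predecessor of `F M e` lies before `e`, unless `F M e` is the
  -- first event of its process.
  have h2 := (Recog.cert (d := d) (F := fun M e => M.pred d (F M e))
    (RecOp.comp (RecOp.pred d) (hop (ZMod 6)))).comap
    (K := ((Unit × Prop) × (Prop × Prop)) × (Prop × Prop)) (fun x => x.2)
  have hfirst : Rec fun M e => ∀ f, ¬ M.nx (!d) (F M e) f :=
    RecOp.comp (Rec.isLast (!d)) (hop Prop)
  have h3 := (Recog.node (P := P) (A := A)
    (fun _ _ (x : (((Unit × Prop) × (Prop × Prop)) × (Prop × Prop)) × Prop) =>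
      (x.1.1.1.2 → x.1.1.2.1) ∧ (¬ x.1.1.1.2 → x.1.2.2 ∨ x.2))).subst hfirst.const
  refine ((h1.and h2).and h3).ex.ex.congr fun M ℓ => ?_
  constructor
  · intro h
    refine ⟨_, _, ⟨MSC.Cert.complete (hF M), MSC.Cert.complete (hF M).pred⟩, fun e => ⟨?_, ?_⟩⟩
    · intro he
      exact (h e).mp he
    · intro he
      have he' : ¬ M.lt d e (F M e) := fun h' => he ((h e).mpr h')
      rw [or_iff_not_imp_right]
      simp only [MSC.nx_not]
      intro hn
      obtain ⟨f, hf⟩ : ∃ f, M.nx d f (F M e) := by simpa using hn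
      rw [MSC.pred_eq hf]
      rcases MSC.ord_or_lt d ((hF M).loc e) with h4 | h4
      · exact hf.lt.trans_ord h4
      · exact absurd h4 he'
  · rintro ⟨κ, κ', ⟨h1, h2⟩, h3⟩ e
    refine propext ⟨fun he => (h1.sound (hF M) e).1 ((h3 e).1 he), fun he => ?_⟩
    by_contra hc
    rcases (h3 e).2 hc with h4 | h4
    · have h5 := (h2.sound (hF M).pred e).2 h4
      have h6 := MSC.pos_pred d (F M e)
      have := h5.2
      have := he.2
      omega
    · simp only [MSC.nx_not] at h4
      obtain ⟨f, hf, -⟩ := he.exists_nx'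
      exact h4 f hf

end

/-! ### Basic operators: until, jump, message edges -/

section RecOp

theorem MSC.internal_or (M : MSC P A) (e : M.E) :
    M.IsInternal e ∨ (∃ f, M.msg e f) ∨ ∃ f, M.msg f e := by
  by_cases h : ∃ f, M.msg e f
  · exact Or.inr (Or.inl h)
  · by_cases h' : ∃ f, M.msg f e
    · exact Or.inr (Or.inr h')
    · push Not at h h'
      exact Or.inl fun f => ⟨h f, h' f⟩

theorem MSC.not_msg_msg {M : MSC P A} {e f g : M.E} (h : M.msg e f) (h' : M.msg f g) : False := by
  obtain ⟨rfl, rfl⟩ := M.msg_unique _ _ _ _ h h' (Or.inr (Or.inr (Or.inl rfl)))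
  exact M.msg_loc _ _ h rfl

theorem MSC.msg_right_unique {M : MSC P A} {e f g : M.E} (h : M.msg e f) (h' : M.msg e g) :
    f = g :=
  (M.msg_unique _ _ _ _ h h' (Or.inl rfl)).2

theorem MSC.msg_left_unique {M : MSC P A} {e f g : M.E} (h : M.msg f e) (h' : M.msg g e) :
    f = g :=
  (M.msg_unique _ _ _ _ h h' (Or.inr (Or.inr (Or.inr rfl)))).1

/-- The operator "strict until" along the processes. -/
theorem RecOp.upto (d : Bool) : RecOp (P := P) (A := A) fun M (z : M.E → Prop × Prop) e =>
    ∃ f, M.lt d e f ∧ (∀ g, M.lt d e g → M.lt d g f → (z g).1) ∧ (z f).2 := by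
  have h1 := Recog.last (P := P) (A := A) d (fun x : (Prop × Prop) × Prop => ¬ x.2)
  have h2 := Recog.edge (P := P) (A := A) d
    (fun x y : (Prop × Prop) × Prop => x.2 ↔ y.1.2 ∨ (y.1.1 ∧ y.2))
  refine (h1.and h2).congr fun M ℓ => ?_
  have hlast : ∀ e, (∀ f, ¬ M.nx d e f) → ¬ ∃ f, M.lt d e f ∧
      (∀ g, M.lt d e g → M.lt d g f → (ℓ g).1.1) ∧ (ℓ f).1.2 := by
    rintro e he ⟨f, hf, -⟩
    obtain ⟨g, hg, -⟩ := hf.exists_nx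
    exact he g hg
  -- The expansion law of until. Together with the value at the last event, it determines the
  -- labelling by induction from the end of the process.
  have hstep : ∀ e f, M.nx d e f → ((∃ h, M.lt d e h ∧
      (∀ g, M.lt d e g → M.lt d g h → (ℓ g).1.1) ∧ (ℓ h).1.2) ↔ (ℓ f).1.2 ∨ ((ℓ f).1.1 ∧
      ∃ h, M.lt d f h ∧ (∀ g, M.lt d f g → M.lt d g h → (ℓ g).1.1) ∧ (ℓ h).1.2)) := by
    intro e f hef
    constructor
    · rintro ⟨h, hh, hb, hz⟩
      rcases MSC.eq_or_lt_of_ord (hef.ord_of_lt hh) with rfl | hfh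
      · exact Or.inl hz
      · exact Or.inr ⟨hb f hef.lt hfh, h, hfh, fun g hg => hb g (hef.lt.ord.trans_lt hg), hz⟩
    · rintro (hz | ⟨hx, h, hh, hb, hz⟩)
      · exact ⟨f, hef.lt, fun g hg hg' => absurd (hef.ord_of_lt hg) hg'.not_ord, hz⟩
      · refine ⟨h, hef.lt.ord.trans_lt hh, fun g hg hg' => ?_, hz⟩
        rcases MSC.eq_or_lt_of_ord (hef.ord_of_lt hg) with rfl | hfg
        · exact hx
        · exact hb g hfg hg'
  constructor
  · intro h
    simp only [h]
    exact ⟨hlast, hstep⟩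
  · rintro ⟨h, h'⟩ e
    induction e using MSC.nx_induction d with
    | h e ih =>
      apply propext
      by_cases he : ∃ f, M.nx d e f
      · obtain ⟨f, hf⟩ := he
        rw [h' e f hf, ih f hf]
        exact (hstep e f hf).symm
      · push Not at he
        exact iff_of_false (h e he) (hlast e he)

/-- The operator "at some event of the process `q`". -/
theorem RecOp.jump (q : P) : RecOp (P := P) (A := A) fun M (z : M.E → Prop) _ =>
    ∃ f, M.loc f = q ∧ z f := by
  have h1 := Recog.edge (P := P) (A := A) true
    (fun x y : (Prop × Prop) × Prop => x.1.2 = y.1.2)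
  -- The bit is constant along each process, but only the acceptance condition sees all processes.
  -- It checks that the bits agree, and that they match the truth as read off at the last event of
  -- `q`; if `q` has no event, `γ` is false.
  have h2 := Recog.acc (P := P) (A := A) (fun t : P → Option ((Prop × Prop) × Prop) =>
    ∃ γ : Prop, (∀ p x, t p = some x → (x.1.2 ↔ γ)) ∧
      (γ ↔ ∃ x, t q = some x ∧ (x.1.1 ∨ x.2)))
  have h3 : RecOp (P := P) (A := A) fun M (z : M.E → Prop × Prop) e =>
      ∃ f, M.lt false e f ∧ (∀ g, M.lt false e g → M.lt false g f → True) ∧ (z f).1 :=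
    RecOp.comp (RecOp.pointwise fun _ _ (x : Prop × Prop) => (True, x.1)) (RecOp.upto false)
  refine ((h1.and h2).subst h3).congr fun M ℓ => ?_
  simp only [implies_true, true_and]
  have hseen : (∃ f, M.loc f = q ∧ (ℓ f).1) ↔ ∃ x, (M.lastEv q).map (fun e => (ℓ e,
      ∃ f, M.lt false e f ∧ (ℓ f).1)) = some x ∧ (x.1.1 ∨ x.2) := by
    rcases hq : M.lastEv q with _ | e
    · have := MSC.lastEv_eq_none.1 hq
      simp only [Option.map_none, reduceCtorEq, false_and, exists_false, iff_false]
      rintro ⟨f, hf, -⟩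
      exact this.false ⟨f, hf⟩
    · have h := MSC.lastEv_eq_some.1 hq
      simp only [Option.map_some, Option.some.injEq, exists_eq_left']
      constructor
      · rintro ⟨f, hf, hz⟩
        rcases MSC.eq_or_lt_of_ord (MSC.leProc_iff.1 (h.2 f hf)) with rfl | hlt
        · exact Or.inl hz
        · exact Or.inr ⟨f, MSC.lt_not.2 hlt, hz⟩
      · rintro (hz | ⟨f, hf, hz⟩)
        · exact ⟨e, h.1, hz⟩
        · exact ⟨f, hf.1.symm.trans h.1, hz⟩
  constructor
  · intro h
    refine ⟨fun e f _ => by rw [h, h], _, fun p x hx => ?_, hseen⟩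
    obtain ⟨e, -, rfl⟩ := Option.map_eq_some_iff.1 hx
    exact iff_of_eq (h e)
  · rintro ⟨h, γ, h1, h2⟩ e
    apply propext
    rw [hseen, ← h2]
    induction e using MSC.nx_induction true with
    | h e ih =>
      by_cases he : ∃ f, M.nx true e f
      · obtain ⟨f, hf⟩ := he
        rw [h e f hf]
        exact ih f hf
      · push Not at he
        have hl := MSC.lastEv_loc_iff.2 he
        exact h1 (M.loc e) _ (by rw [hl]; rfl)

theorem RecOp.msg (p q : P) : RecOp (P := P) (A := A) fun M (z : M.E → Prop) e =>
    ∃ f, (M.loc e = p ∧ M.loc f = q ∧ M.msg e f) ∧ z f := by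
  -- Every event is internal or an end of a message edge, so the constraints there fix the bit
  -- everywhere, with value false at receive events.
  have h1 := Recog.msg (P := P) (A := A) (fun p' (x : Prop × Prop) q' y =>
    (x.2 ↔ p' = p ∧ q' = q ∧ y.1) ∧ ¬ y.2)
  have h2 := Recog.int (P := P) (A := A) (fun x : Prop × Prop => ¬ x.2)
  refine (h1.and h2).congr fun M ℓ => ?_
  have hstep : ∀ e f, M.msg e f → ((∃ f, (M.loc e = p ∧ M.loc f = q ∧ M.msg e f) ∧ (ℓ f).1) ↔
      M.loc e = p ∧ M.loc f = q ∧ (ℓ f).1) := by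
    intro e f hef
    constructor
    · rintro ⟨g, ⟨h1, h2, h3⟩, h4⟩
      obtain rfl := MSC.msg_right_unique hef h3
      exact ⟨h1, h2, h4⟩
    · rintro ⟨h1, h2, h3⟩
      exact ⟨f, ⟨h1, h2, hef⟩, h3⟩
  constructor
  · intro h
    simp only [h]
    refine ⟨fun e f hef => ⟨hstep e f hef, ?_⟩, fun e he => ?_⟩
    · rintro ⟨g, ⟨-, -, h3⟩, -⟩
      exact MSC.not_msg_msg hef h3
    · rintro ⟨g, ⟨-, -, h3⟩, -⟩
      exact (he g).1 h3
  · rintro ⟨h, h'⟩ e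
    apply propext
    rcases M.internal_or e with he | ⟨f, hf⟩ | ⟨f, hf⟩
    · refine iff_of_false (h' e he) ?_
      rintro ⟨g, ⟨-, -, h3⟩, -⟩
      exact (he g).1 h3
    · rw [(h e f hf).1]
      exact (hstep e f hf).symm
    · refine iff_of_false (h f e hf).2 ?_
      rintro ⟨g, ⟨-, -, h3⟩, -⟩
      exact MSC.not_msg_msg hf h3

theorem RecOp.msgInv (p q : P) : RecOp (P := P) (A := A) fun M (z : M.E → Prop) e =>
    ∃ f, (M.loc e = p ∧ M.loc f = q ∧ M.msg f e) ∧ z f := by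
  have h1 := Recog.msg (P := P) (A := A) (fun p' (x : Prop × Prop) q' y =>
    (y.2 ↔ q' = p ∧ p' = q ∧ x.1) ∧ ¬ x.2)
  have h2 := Recog.int (P := P) (A := A) (fun x : Prop × Prop => ¬ x.2)
  refine (h1.and h2).congr fun M ℓ => ?_
  have hstep : ∀ e f, M.msg f e → ((∃ f, (M.loc e = p ∧ M.loc f = q ∧ M.msg f e) ∧ (ℓ f).1) ↔
      M.loc e = p ∧ M.loc f = q ∧ (ℓ f).1) := by
    intro e f hef
    constructor
    · rintro ⟨g, ⟨h1, h2, h3⟩, h4⟩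
      obtain rfl := MSC.msg_left_unique hef h3
      exact ⟨h1, h2, h4⟩
    · rintro ⟨h1, h2, h3⟩
      exact ⟨f, ⟨h1, h2, hef⟩, h3⟩
  constructor
  · intro h
    simp only [h]
    refine ⟨fun f e hef => ⟨hstep e f hef, ?_⟩, fun e he => ?_⟩
    · rintro ⟨g, ⟨-, -, h3⟩, -⟩
      exact MSC.not_msg_msg h3 hef
    · rintro ⟨g, ⟨-, -, h3⟩, -⟩
      exact (he g).2 h3
  · rintro ⟨h, h'⟩ e
    apply propext
    rcases M.internal_or e with he | ⟨f, hf⟩ | ⟨f, hf⟩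
    · refine iff_of_false (h' e he) ?_
      rintro ⟨g, ⟨-, -, h3⟩, -⟩
      exact (he g).2 h3
    · refine iff_of_false (h e f hf).2 ?_
      rintro ⟨g, ⟨-, -, h3⟩, -⟩
      exact MSC.not_msg_msg h3 hf
    · rw [(h f e hf).1]
      exact (hstep e f hf).symm

end RecOp

/-! ### Path expressions and their lattice property -/

/-- A family of binary relations on the events of MSCs. -/
abbrev EvRel (P : Type u) (A : Type v) := ∀ M : MSC P A, M.E → M.E → Prop

/-- EvPath expressions from the process `p` to the process `q`. -/
inductive EvPath : P → P → EvRel P A → Prop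
  | test (p : P) (X : ∀ M : MSC P A, M.E → Prop) (hX : Rec X) :
    EvPath p p fun M e f => e = f ∧ M.loc e = p ∧ X M e
  | upto (d : Bool) (p : P) (X : ∀ M : MSC P A, M.E → Prop) (hX : Rec X) :
    EvPath p p fun M e f => M.loc e = p ∧ M.lt d e f ∧ ∀ g, M.lt d e g → M.lt d g f → X M g
  | msg (p q : P) : EvPath p q fun M e f => M.loc e = p ∧ M.loc f = q ∧ M.msg e f
  | msgInv (p q : P) : EvPath p q fun M e f => M.loc e = p ∧ M.loc f = q ∧ M.msg f e
  | jump (p q : P) : EvPath p q fun M e f => M.loc e = p ∧ M.loc f = q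
  | comp {p q r : P} {R S : EvRel P A} (hR : EvPath p q R) (hS : EvPath q r S) :
    EvPath p r fun M e f => ∃ g, R M e g ∧ S M g f

namespace EvPath

variable {p q r : P} {R S : EvRel P A}

theorem congr (h : EvPath p q R) (hS : ∀ M e f, S M e f ↔ R M e f) : EvPath p q S := by
  have : S = R := by
    funext M e f
    exact propext (hS M e f)
  exact this ▸ h

theorem loc (h : EvPath p q R) {M : MSC P A} {e f : M.E} (hef : R M e f) :
    M.loc e = p ∧ M.loc f = q := by
  induction h generalizing e f with
  | test p X hX => exact ⟨hef.2.1, hef.1 ▸ hef.2.1⟩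
  | upto d p X hX => exact ⟨hef.1, hef.2.1.1.symm.trans hef.1⟩
  | msg p q => exact ⟨hef.1, hef.2.1⟩
  | msgInv p q => exact ⟨hef.1, hef.2.1⟩
  | jump p q => exact hef
  | comp _ _ ihR ihS =>
    obtain ⟨g, h1, h2⟩ := hef
    exact ⟨(ihR h1).1, (ihS h2).2⟩

theorem inv (h : EvPath p q R) : EvPath q p fun M e f => R M f e := by
  induction h with
  | test p X hX =>
    refine (test p X hX).congr fun M e f => ?_
    constructor <;> rintro ⟨rfl, h⟩ <;> exact ⟨rfl, h⟩
  | upto d p X hX =>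
    refine (upto (!d) p X hX).congr fun M e f => ?_
    simp only [MSC.lt_not]
    constructor
    · rintro ⟨h1, h2, h3⟩
      exact ⟨h2.1.symm.trans h1, h2, fun g hg hg' => h3 g hg' hg⟩
    · rintro ⟨h1, h2, h3⟩
      exact ⟨h2.1.trans h1, h2, fun g hg hg' => h3 g hg' hg⟩
  | msg p q => exact (msgInv q p).congr fun M e f => by tauto
  | msgInv p q => exact (msg q p).congr fun M e f => by tauto
  | jump p q => exact (jump q p).congr fun M e f => and_comm
  | comp _ _ ihR ihS =>
    exact (ihS.comp ihR).congr fun M e f => by simp only [and_comm]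

/-- The diamond modality of a path expression. It turns composition of paths into composition of
operators, so only the generators need a recognizing system. -/
theorem dia (h : EvPath p q R) :
    RecOp fun M (z : M.E → Prop) e => ∃ f, R M e f ∧ z f := by
  induction h with
  | test p X hX =>
    refine (RecOp.map₂ (RecOp.prod (Rec.node fun l _ => l = p).const hX.const)
      (RecOp.pointwise fun _ _ x => x) fun x y => x.1 ∧ x.2 ∧ y).congr fun M ℓ e => ?_
    simp [and_assoc]
  | upto d p X hX =>
    refine (RecOp.map₂ (Rec.node fun l _ => l = p).const (RecOp.comp (RecOp.prod hX.const
      (RecOp.pointwise fun _ _ x => x)) (RecOp.upto d)) And).congr fun M ℓ e => ?_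
    simp only [and_assoc, exists_and_left]
  | msg p q => exact RecOp.msg p q
  | msgInv p q => exact RecOp.msgInv p q
  | jump p q =>
    refine (RecOp.map₂ (Rec.node fun l _ => l = p).const (RecOp.jump q) And).congr
      fun M ℓ e => ?_
    simp only [and_assoc, exists_and_left]
  | comp _ _ ihR ihS =>
    refine (ihS.comp ihR).congr fun M ℓ e => propext ?_
    constructor
    · rintro ⟨f, ⟨g, h1, h2⟩, h3⟩
      exact ⟨g, h1, f, h2, h3⟩
    · rintro ⟨g, h1, f, h2, h3⟩
      exact ⟨f, ⟨g, h1, h2⟩, h3⟩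

theorem dom (h : EvPath p q R) : Rec fun M e => ∃ f, R M e f :=
  (h.dia.apply Rec.top).congr fun M e => by simp

theorem codom (h : EvPath p q R) : Rec fun M f => ∃ e, R M e f := h.inv.dom

/-- On the processes `p` and `q`, a path expression is a sublattice. -/
theorem lattice (h : EvPath p q R) {M : MSC P A} (d : Bool) {e e' f f' : M.E} (he : M.ord d e e')
    (hf : M.ord d f f') (h1 : R M e f') (h2 : R M e' f) : R M e f ∧ R M e' f' := by
  -- Exchanging the two given pairs turns the claim for one direction into the claim for the other,
  -- so generators are checked in one convenient direction only.
  have flip : ∀ {R : EvRel P A} (d' : Bool), (∀ {e e' f f' : M.E}, M.ord d' e e' → M.ord d' f f' →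
      R M e f' → R M e' f → R M e f ∧ R M e' f') → ∀ {d : Bool} {e e' f f' : M.E},
      M.ord d e e' → M.ord d f f' → R M e f' → R M e' f → R M e f ∧ R M e' f' := by
    intro R d' h d e e' f f' he hf h1 h2
    by_cases hd : d = d'
    · subst hd
      exact h he hf h1 h2
    · obtain rfl : d = !d' := by cases d <;> cases d' <;> simp_all
      rw [MSC.ord_not] at he hf
      exact (h he hf h2 h1).symm
  induction h generalizing d e e' f f' with
  | test p X hX =>
    obtain ⟨rfl, h1⟩ := h1
    obtain ⟨rfl, h2⟩ := h2
    obtain rfl := he.antisymm hf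
    exact ⟨⟨rfl, h1⟩, ⟨rfl, h1⟩⟩
  | upto d' p X hX =>
    refine flip (R := fun M e f => M.loc e = p ∧ M.lt d' e f ∧
      ∀ g, M.lt d' e g → M.lt d' g f → X M g) d' ?_ he hf h1 h2
    rintro e e' f f' he hf ⟨h1, h2, h3⟩ ⟨h4, h5, h6⟩
    exact ⟨⟨h1, he.trans_lt h5, fun g hg hg' => h3 g hg (hg'.trans_ord hf)⟩,
      ⟨h4, h5.trans_ord hf, fun g hg hg' => h3 g (he.trans_lt hg) hg'⟩⟩
  | msg p q =>
    refine flip (R := fun M e f => M.loc e = p ∧ M.loc f = q ∧ M.msg e f) true ?_ he hf h1 h2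
    rintro e e' f f' he hf ⟨h1, h2, h3⟩ ⟨h4, h5, h6⟩
    -- FIFO forbids crossing: the receive events are ordered both ways, so the two message edges
    -- coincide.
    have h7 := (M.fifo _ _ _ _ h3 h6 he.1 hf.1.symm).1 (MSC.leProc_iff.2 he)
    obtain rfl := hf.antisymm (MSC.leProc_iff.1 h7)
    obtain rfl := MSC.msg_left_unique h3 h6
    exact ⟨⟨h1, h2, h3⟩, ⟨h1, h2, h3⟩⟩
  | msgInv p q =>
    refine flip (R := fun M e f => M.loc e = p ∧ M.loc f = q ∧ M.msg f e) true ?_ he hf h1 h2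
    rintro e e' f f' he hf ⟨h1, h2, h3⟩ ⟨h4, h5, h6⟩
    have h7 := (M.fifo _ _ _ _ h6 h3 hf.1 he.1.symm).1 (MSC.leProc_iff.2 hf)
    obtain rfl := he.antisymm (MSC.leProc_iff.1 h7)
    obtain rfl := MSC.msg_left_unique h3 h6
    exact ⟨⟨h1, h2, h3⟩, ⟨h1, h2, h3⟩⟩
  | jump p q => exact ⟨⟨h1.1, h2.2⟩, ⟨h2.1, h1.2⟩⟩
  | comp hR hS ihR ihS =>
    obtain ⟨g, h3, h4⟩ := h1
    obtain ⟨g', h5, h6⟩ := h2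
    -- If the intermediate events are in order, the second halves of the two paths are exchanged,
    -- and otherwise the first halves.
    rcases MSC.ord_or_lt d ((hR.loc h3).2.trans (hR.loc h5).2.symm) with hg | hg
    · have := ihS d hg hf h4 h6
      exact ⟨⟨g, h3, this.1⟩, ⟨g', h5, this.2⟩⟩
    · have := ihR d he hg.ord h3 h5
      exact ⟨⟨g', this.1, h6⟩, ⟨g, this.2, h4⟩⟩

/-- The image of an event is convex in the codomain. -/
theorem convex (h : EvPath p q R) {M : MSC P A} {d : Bool} {e g f₁ f f₂ : M.E} (h1 : R M e f₁)
    (h2 : R M e f₂) (hg : R M g f) (hf1 : M.ord d f₁ f) (hf2 : M.ord d f f₂) : R M e f := by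
  rcases MSC.ord_or_lt d ((h.loc h1).1.trans (h.loc hg).1.symm) with heg | heg
  · exact (h.lattice d heg hf2 h2 hg).1
  · exact (h.lattice d heg.ord hf1 hg h1).2

/-- The restriction of the codomain to `Z`. -/
theorem restrict (h : EvPath p q R) {Z : ∀ M : MSC P A, M.E → Prop} (hZ : Rec Z) :
    EvPath p q fun M e f => R M e f ∧ Z M f := by
  refine (h.comp (test q Z hZ)).congr fun M e f => ?_
  constructor
  · rintro ⟨h1, h2⟩
    exact ⟨f, h1, rfl, (h.loc h1).2, h2⟩
  · rintro ⟨g, h1, rfl, -, h2⟩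
    exact ⟨h1, h2⟩

/-- The extra set `Z` is what makes the induction pass through compositions: the first half must aim
at the least intermediate event from which the second half can still reach `Z`. -/
theorem least_restrict (d : Bool) (h : EvPath p q R) :
    ∀ Z : ∀ M : MSC P A, M.E → Prop, Rec Z →
      EvPath p q fun M e f => R M e f ∧ Z M f ∧ ∀ f', R M e f' → Z M f' → M.ord d f f' := by
  induction h with
  | test p X hX =>
    intro Z hZ
    refine ((test p X hX).restrict hZ).congr fun M e f => ?_
    constructor
    · rintro ⟨h1, h2, -⟩
      exact ⟨h1, h2⟩
    · rintro ⟨⟨rfl, h1⟩, h2⟩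
      refine ⟨⟨rfl, h1⟩, h2, ?_⟩
      rintro _ ⟨rfl, -⟩ -
      exact MSC.ord_refl d _
  | upto d' p X hX =>
    intro Z hZ
    by_cases hd : d' = d
    · subst hd
      refine ((upto d' p _ (hX.and hZ.not)).restrict hZ).congr fun M e f => ?_
      constructor
      · rintro ⟨⟨h1, h2, h3⟩, h4, h5⟩
        refine ⟨⟨h1, h2, fun g hg hg' => ⟨h3 g hg hg', fun hz => ?_⟩⟩, h4⟩
        exact hg'.not_ord (h5 g ⟨h1, hg, fun k hk hk' => h3 k hk (hk'.trans_ord hg'.ord)⟩ hz)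
      · rintro ⟨⟨h1, h2, h3⟩, h4⟩
        refine ⟨⟨h1, h2, fun g hg hg' => (h3 g hg hg').1⟩, h4, ?_⟩
        rintro f' ⟨-, h5, -⟩ hz
        rcases MSC.ord_or_lt d' (h2.1.symm.trans h5.1) with h7 | h7
        · exact h7
        · exact absurd hz (h3 f' h5 h7).2
    · obtain rfl : d = !d' := by cases d <;> cases d' <;> simp_all
      have h0 := upto d' p X hX
      -- Here the path runs against `d`, so the least target is the farthest one. This is a
      -- condition at `f` alone: the path cannot be prolonged beyond `f` to another event of `Z`.
      have hZ' := hZ.and (hX.and ((h0.dia.apply hZ))).not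
      refine (h0.restrict hZ').congr fun M e f => ?_
      simp only [MSC.ord_not]
      constructor
      · rintro ⟨⟨h1, h2, h3⟩, h4, h5⟩
        refine ⟨⟨h1, h2, h3⟩, h4, ?_⟩
        rintro ⟨hx, f', ⟨-, h6, h7⟩, hz⟩
        refine h6.not_ord (h5 f' ⟨h1, h2.trans_ord h6.ord, fun g hg hg' => ?_⟩ hz)
        rcases MSC.ord_or_lt d' (hg.1.symm.trans h2.1) with h8 | h8
        · rcases MSC.eq_or_lt_of_ord h8 with rfl | h8
          · exact hx
          · exact h3 g hg h8
        · exact h7 g h8 hg'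
      · rintro ⟨⟨h1, h2, h3⟩, h4, h5⟩
        refine ⟨⟨h1, h2, h3⟩, h4, ?_⟩
        rintro f' ⟨-, h6, h7⟩ hz
        rcases MSC.ord_or_lt d' (h6.1.symm.trans h2.1) with h8 | h8
        · exact h8
        · exact absurd ⟨h7 f h2 h8, f', ⟨h2.1.symm.trans h1, h8,
            fun g hg hg' => h7 g (h2.ord.trans_lt hg) hg'⟩, hz⟩ h5
  | msg p q =>
    intro Z hZ
    refine ((msg p q).restrict hZ).congr fun M e f => ?_
    constructor
    · rintro ⟨h1, h2, -⟩
      exact ⟨h1, h2⟩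
    · rintro ⟨h1, h2⟩
      refine ⟨h1, h2, fun f' h3 _ => ?_⟩
      rw [MSC.msg_right_unique h1.2.2 h3.2.2]
      exact MSC.ord_refl d _
  | msgInv p q =>
    intro Z hZ
    refine ((msgInv p q).restrict hZ).congr fun M e f => ?_
    constructor
    · rintro ⟨h1, h2, -⟩
      exact ⟨h1, h2⟩
    · rintro ⟨h1, h2⟩
      refine ⟨h1, h2, fun f' h3 _ => ?_⟩
      rw [MSC.msg_left_unique h1.2.2 h3.2.2]
      exact MSC.ord_refl d _
  | jump p q =>
    intro Z hZ
    have h0 := upto (A := A) (!d) q _ Rec.top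
    refine ((jump p q).restrict (hZ.and (h0.dia.apply hZ).not)).congr fun M e f => ?_
    constructor
    · rintro ⟨h1, h2, h3⟩
      refine ⟨h1, h2, ?_⟩
      rintro ⟨f', ⟨-, h4, -⟩, h5⟩
      rw [MSC.lt_not] at h4
      exact h4.not_ord (h3 f' ⟨h1.1, h4.1.trans h1.2⟩ h5)
    · rintro ⟨h1, h2, h3⟩
      refine ⟨h1, h2, fun f' h4 h5 => ?_⟩
      rcases MSC.ord_or_lt d (h1.2.trans h4.2.symm) with h6 | h6
      · exact h6
      · exact absurd ⟨f', ⟨h1.2, MSC.lt_not.2 h6, fun _ _ _ => trivial⟩, h5⟩ h3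
  | @comp p q r R S hR hS ihR ihS =>
    intro Z hZ
    refine ((ihR _ (hS.dia.apply hZ)).comp (ihS Z hZ)).congr fun M e f => ?_
    constructor
    · rintro ⟨⟨g, h1, h2⟩, h3, h4⟩
      obtain ⟨g₀, ⟨h5, f₀, h6, h7⟩, h8⟩ := MSC.exists_least d (p := q)
        (X := fun g => R M e g ∧ ∃ f, S M g f ∧ Z M f) ⟨g, h1, f, h2, h3⟩
        (fun g hg => (hR.loc hg.1).2)
      refine ⟨g₀, ⟨h5, ⟨f₀, h6, h7⟩, fun f' h h' => h8 f' ⟨h, h'⟩⟩, ?_, h3,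
        fun f' h h' => h4 f' ⟨g₀, h5, h⟩ h'⟩
      -- The least intermediate event `g₀` reaches the least target as well: exchange second halves
      -- with the path through `g`.
      exact (hS.lattice d (h8 g ⟨h1, f, h2, h3⟩) (h4 f₀ ⟨g₀, h5, h6⟩ h7) h6 h2).1
    · rintro ⟨g, ⟨h1, h2, h3⟩, h4, h5, h6⟩
      refine ⟨⟨g, h1, h4⟩, h5, ?_⟩
      rintro f' ⟨g', h7, h8⟩ h9
      rcases MSC.ord_or_lt d ((hS.loc h4).2.trans (hS.loc h8).2.symm) with h10 | h10
      · exact h10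
      · exact h6 f' (hS.lattice d (h3 g' h7 ⟨f', h8, h9⟩) h10.ord h4 h8).1 h9

/-- The least element of the image. -/
theorem least (d : Bool) (h : EvPath p q R) :
    EvPath p q fun M e f => R M e f ∧ ∀ f', R M e f' → M.ord d f f' :=
  (h.least_restrict d _ Rec.top).congr fun M e f => by simp

theorem exists_least (d : Bool) (h : EvPath p q R) {M : MSC P A} {e : M.E} (he : ∃ f, R M e f) :
    ∃ f, R M e f ∧ ∀ f', R M e f' → M.ord d f f' :=
  MSC.exists_least d he fun _ hf => (h.loc hf).2

end EvPath

/-! ### Loops: the diagonal of a path expression -/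

theorem MSC.exists_last (M : MSC P A) (d : Bool) (e : M.E) :
    ∃ z, M.loc z = M.loc e ∧ ∀ g, ¬ M.nx d z g := by
  obtain ⟨z, hz, h⟩ := MSC.exists_least (M := M) (!d) (p := M.loc e)
    (X := fun z => M.loc z = M.loc e) ⟨e, rfl⟩ (fun _ h => h)
  exact ⟨z, hz, fun g hg =>
    hg.lt.not_ord (MSC.ord_not.1 (h g ((MSC.nx_loc hg).symm.trans hz)))⟩

/-- The last event of the process is admitted so that the minimum exists even if no event at or
after `x` has an image. -/
theorem exists_least_image_after (d : Bool) (R : EvRel P A) (M : MSC P A) (x : M.E) : ∃ z,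
    (M.loc z = M.loc x ∧ ((∃ y, M.ord d x y ∧ R M y z) ∨ ∀ g, ¬ M.nx d z g)) ∧
    ∀ z', (M.loc z' = M.loc x ∧ ((∃ y, M.ord d x y ∧ R M y z') ∨ ∀ g, ¬ M.nx d z' g)) →
      M.ord d z z' := by
  obtain ⟨z, hz, hl⟩ := M.exists_last d x
  exact MSC.exists_least d ⟨z, hz, Or.inr hl⟩ fun _ h => h.1

/-- The total function that maps `x` to the least element of the image under `R` of the events at or
after `x`, and to the last event of the process if there is none. -/
noncomputable def leastAfter (d : Bool) (R : EvRel P A) (M : MSC P A) (x : M.E) : M.E :=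
  (exists_least_image_after d R M x).choose

theorem leastAfter_eq {d : Bool} {R : EvRel P A} {M : MSC P A} {x z : M.E}
    (hz : M.loc z = M.loc x ∧ ((∃ y, M.ord d x y ∧ R M y z) ∨ ∀ g, ¬ M.nx d z g))
    (h : ∀ z', (M.loc z' = M.loc x ∧ ((∃ y, M.ord d x y ∧ R M y z') ∨ ∀ g, ¬ M.nx d z' g)) →
      M.ord d z z') : leastAfter d R M x = z :=
  ((exists_least_image_after d R M x).choose_spec.2 z hz).antisymm
    (h _ (exists_least_image_after d R M x).choose_spec.1)

/-- The set whose minimum is taken shrinks as the argument advances. -/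
theorem leastAfter_mono (d : Bool) (R : EvRel P A) (M : MSC P A) :
    MSC.Mono d (leastAfter d R M) where
  loc e := (exists_least_image_after d R M e).choose_spec.1.1
  mono e f h := by
    refine (exists_least_image_after d R M e).choose_spec.2 _ ?_
    obtain ⟨h1, h2⟩ := (exists_least_image_after d R M f).choose_spec.1
    refine ⟨h1.trans h.1.symm, h2.imp_left ?_⟩
    rintro ⟨y, hy, hR⟩
    exact ⟨y, h.trans hy, hR⟩

namespace EvPath

variable {p : P} {R : EvRel P A}

/-- Later events cannot contribute anything smaller: if `y` after `x` had an image before `f`, the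
lattice property would make it an image of `x` too. -/
theorem leastAfter_of_least (h : EvPath p p R) {d : Bool} {M : MSC P A} {x f : M.E} (hf : R M x f)
    (hl : ∀ f', R M x f' → M.ord d f f') : leastAfter d R M x = f := by
  have hfx : M.loc f = M.loc x := (h.loc hf).2.trans (h.loc hf).1.symm
  refine leastAfter_eq ⟨hfx, Or.inl ⟨x, MSC.ord_refl d x, hf⟩⟩ ?_
  rintro z ⟨hz, ⟨y, hy, hR⟩ | hlast⟩
  · rcases MSC.ord_or_lt d (hfx.trans hz.symm) with h1 | h1
    · exact h1
    · exact hl z (h.lattice d hy h1.ord hf hR).1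
  · exact MSC.ord_of_last hlast (hfx.trans hz.symm)

/-- On the domain of `R` the value is fetched by the path expression for the least image, one
diamond for each possible label. Outside the domain it is inherited from the next event, and at a
last event it is the event's own label. -/
theorem comp_leastAfter (h : EvPath p p R) (d : Bool) (K : Type) [Finite K] :
    RecOp fun M (ℓ : M.E → K) e => ℓ (leastAfter d R M e) := by
  have h1 := ((Recog.edge (P := P) (A := A) d
    (fun x y : (K × K) × Prop => ¬ x.2 → x.1.2 = y.1.2)).and
    (Recog.last (P := P) (A := A) d (fun x : (K × K) × Prop => ¬ x.2 → x.1.2 = x.1.1))).subst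
    (h.dom.const (L := K × K))
  have h2 := Recog.all fun k : K => (Recog.node (P := P) (A := A)
    (fun _ _ (x : ((K × K) × Prop) × Prop) => x.1.2 → (x.1.1.2 = k ↔ x.2))).subst
    ((RecOp.pointwise (P := P) (A := A) fun _ _ (x : (K × K) × Prop) => x.1.1 = k).comp
      (h.least d).dia)
  refine (h1.and (h2.subst (h.dom.const (L := K × K)))).congr fun M ℓ => ?_
  have hnotdom : ∀ e, (¬ ∃ f, R M e f) → ∀ y, M.ord d e y → ∀ z, R M y z → M.lt d e y := by
    intro e he y hy z hz
    rcases MSC.eq_or_lt_of_ord hy with rfl | h1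
    · exact absurd ⟨z, hz⟩ he
    · exact h1
  have hnx : ∀ e f, M.nx d e f → (¬ ∃ f, R M e f) → leastAfter d R M e = leastAfter d R M f := by
    intro e f hef he
    obtain ⟨⟨h1, h2⟩, h3⟩ := (exists_least_image_after d R M f).choose_spec
    refine leastAfter_eq ⟨h1.trans (MSC.nx_loc hef).symm, h2.imp_left ?_⟩ ?_
    · rintro ⟨y, hy, hR⟩
      exact ⟨y, hef.lt.ord.trans hy, hR⟩
    · rintro z ⟨h4, h5⟩
      refine h3 z ⟨h4.trans (MSC.nx_loc hef), h5.imp_left ?_⟩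
      rintro ⟨y, hy, hR⟩
      exact ⟨y, hef.ord_of_lt (hnotdom e he y hy z hR), hR⟩
  have hlast : ∀ e, (∀ f, ¬ M.nx d e f) → (¬ ∃ f, R M e f) → leastAfter d R M e = e := by
    intro e hl he
    refine leastAfter_eq ⟨rfl, Or.inr hl⟩ ?_
    rintro z ⟨h4, ⟨y, hy, hR⟩ | h5⟩
    · obtain ⟨g, hg, -⟩ := (hnotdom e he y hy z hR).exists_nx
      exact absurd hg (hl g)
    · exact MSC.ord_of_last h5 h4.symm
  have hdom : ∀ e k, (∃ f, R M e f) → ((ℓ (leastAfter d R M e)).1 = k ↔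
      ∃ f, (R M e f ∧ ∀ f', R M e f' → M.ord d f f') ∧ (ℓ f).1 = k) := by
    intro e k he
    constructor
    · intro hk
      obtain ⟨f, hf, hl⟩ := h.exists_least d he
      exact ⟨f, ⟨hf, hl⟩, by rwa [← h.leastAfter_of_least hf hl]⟩
    · rintro ⟨f, ⟨hf, hl⟩, hk⟩
      rwa [h.leastAfter_of_least hf hl]
  constructor
  · intro h
    simp only [h]
    exact ⟨⟨fun e f hef he => by rw [hnx e f hef he], fun e hl he => by rw [hlast e hl he]⟩,
      fun k e => hdom e k⟩
  · rintro ⟨⟨h1, h2⟩, h3⟩ e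
    change (ℓ e).2 = (ℓ (leastAfter d R M e)).1
    induction e using MSC.nx_induction d with
    | h e ih =>
      by_cases he : ∃ f, R M e f
      · exact (h3 _ e he).2 ((hdom e _ he).1 rfl)
      · by_cases hl : ∃ f, M.nx d e f
        · obtain ⟨f, hf⟩ := hl
          rw [hnx e f hf he, ← ih f hf]
          exact h1 e f hf he
        · push Not at hl
          rw [hlast e hl he]
          exact h2 e hl he

/-- The diagonal of a path expression is recognizable. -/
theorem loop {q : P} (h : EvPath p q R) : Rec fun M e => R M e e := by
  by_cases hpq : p = q
  · subst hpq
    -- For `d = true` the function gives the least image and for `d = false` the greatest one. That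
    -- neither lies beyond `e` says that `e` is between them, and convexity then yields the loop if
    -- `e` is in the codomain.
    have key : ∀ d, Rec fun M e => M.lt d e (leastAfter d R M e) := fun d =>
      Rec.lt_apply (leastAfter_mono d R) (h.comp_leastAfter d)
    refine ((h.dom.and h.codom).and ((key true).not.and (key false).not)).congr fun M e => ?_
    constructor
    · intro he
      refine ⟨⟨⟨e, he⟩, ⟨e, he⟩⟩, ?_⟩
      have : ∀ d, ¬ M.lt d e (leastAfter d R M e) := by
        intro d hlt
        obtain ⟨f, hf, hl⟩ := h.exists_least d ⟨e, he⟩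
        rw [h.leastAfter_of_least hf hl] at hlt
        exact hlt.not_ord (hl e he)
      exact ⟨this true, this false⟩
    · rintro ⟨⟨he, g, hg⟩, h1, h2⟩
      obtain ⟨f, hf, hl⟩ := h.exists_least true he
      obtain ⟨f', hf', hl'⟩ := h.exists_least false he
      rw [h.leastAfter_of_least hf hl] at h1
      rw [h.leastAfter_of_least hf' hl', ← Bool.not_true, MSC.lt_not] at h2
      have hp := (h.loc hg).2
      refine h.convex (d := true) hf hf' hg ?_ ?_
      · exact (MSC.ord_or_lt true ((h.loc hf).2.trans hp.symm)).resolve_right h1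
      · exact (MSC.ord_or_lt true (hp.trans (h.loc hf').2.symm)).resolve_right h2
  · refine Rec.bot.congr fun M e => ?_
    simp only [iff_false]
    intro he
    exact hpq ((h.loc he).1.symm.trans (h.loc he).2)

end EvPath

/-! ### Combinations of path expressions, closed under negation -/

/-- Positive Boolean combinations of path expressions between the events assigned to variables. -/
inductive Def {V : Type} : (∀ M : MSC P A, (V → M.E) → Prop) → Prop
  | lit {p q : P} {R : EvRel P A} (h : EvPath p q R) (i j : V) : Def fun M v => R M (v i) (v j)
  | const (c : Prop) : Def fun _ _ => c
  | and {Φ Ψ : ∀ M : MSC P A, (V → M.E) → Prop} (h : Def Φ) (h' : Def Ψ) :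
    Def fun M v => Φ M v ∧ Ψ M v
  | or {Φ Ψ : ∀ M : MSC P A, (V → M.E) → Prop} (h : Def Φ) (h' : Def Ψ) :
    Def fun M v => Φ M v ∨ Ψ M v

namespace Def

variable {V : Type} {Φ Ψ : ∀ M : MSC P A, (V → M.E) → Prop}

theorem congr (h : Def Φ) (hΨ : ∀ M v, Ψ M v ↔ Φ M v) : Def Ψ := by
  have : Ψ = Φ := by
    funext M v
    exact propext (hΨ M v)
  exact this ▸ h

theorem reindex {W : Type} (g : V → W) (h : Def Φ) :
    Def fun M (v : W → M.E) => Φ M fun i => v (g i) := by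
  induction h with
  | lit h i j => exact lit h _ _
  | const c => exact const c
  | and _ _ ih ih' => exact ih.and ih'
  | or _ _ ih ih' => exact ih.or ih'

theorem exists_mem {ι : Type*} (l : List ι) {Φ : ι → ∀ M : MSC P A, (V → M.E) → Prop}
    (h : ∀ i ∈ l, Def (Φ i)) : Def fun M v => ∃ i ∈ l, Φ i M v := by
  induction l with
  | nil => exact (const False).congr fun _ _ => by simp
  | cons i l ih =>
    exact ((h i (by simp)).or (ih fun j hj => h j (by simp [hj]))).congr fun _ _ => by simp

theorem forall_mem {ι : Type*} (l : List ι) {Φ : ι → ∀ M : MSC P A, (V → M.E) → Prop}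
    (h : ∀ i ∈ l, Def (Φ i)) : Def fun M v => ∀ i ∈ l, Φ i M v := by
  induction l with
  | nil => exact (const True).congr fun _ _ => by simp
  | cons i l ih =>
    exact ((h i (by simp)).and (ih fun j hj => h j (by simp [hj]))).congr fun _ _ => by simp

theorem iExists {ι : Type*} [Finite ι] {Φ : ι → ∀ M : MSC P A, (V → M.E) → Prop}
    (h : ∀ i, Def (Φ i)) : Def fun M v => ∃ i, Φ i M v := by
  have := Fintype.ofFinite ι
  exact (exists_mem Finset.univ.toList fun i _ => h i).congr fun _ _ => by simp

/-- Since images are intervals of the codomain, a path can fail in five ways only: a wrong process,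
a source outside the domain, a target outside the codomain, a target before the least image, or one
after the greatest. -/
theorem not_lit [Finite P] {p q : P} {R : EvRel P A} (h : EvPath p q R) (i j : V) :
    Def fun M v => ¬ R M (v i) (v j) := by
  have h1 : Def fun (M : MSC P A) (v : V → M.E) => ∃ p' q', (p' ≠ p ∨ q' ≠ q) ∧
      (M.loc (v i) = p' ∧ M.loc (v j) = q') :=
    iExists fun p' => iExists fun q' => (const _).and (lit (.jump p' q') i j)
  have h2 := lit ((EvPath.test p _ h.dom.not).comp (.jump p q)) i j
  have h3 := lit ((EvPath.jump p q).restrict h.codom.not) i j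
  have h4 := lit ((h.least true).comp (.upto false q _ Rec.top)) i j
  have h5 := lit ((h.least false).comp (.upto true q _ Rec.top)) i j
  refine (h1.or (h2.or (h3.or (h4.or h5)))).congr fun M v => ?_
  constructor
  · intro hR
    by_cases hp : M.loc (v i) = p
    · by_cases hq : M.loc (v j) = q
      · by_cases hd : ∃ f, R M (v i) f
        · by_cases hc : ∃ e, R M e (v j)
          · obtain ⟨g, hg⟩ := hc
            obtain ⟨f, hf, hl⟩ := h.exists_least true hd
            obtain ⟨f', hf', hl'⟩ := h.exists_least false hd
            rcases MSC.ord_or_lt true ((h.loc hf).2.trans hq.symm) with h1 | h1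
            · rcases MSC.ord_or_lt true (hq.trans (h.loc hf').2.symm) with h2 | h2
              · exact absurd (h.convex hf hf' hg h1 h2) hR
              · exact .inr <| .inr <| .inr <| .inr
                  ⟨f', ⟨hf', hl'⟩, (h.loc hf').2, h2, fun _ _ _ => trivial⟩
            · exact .inr <| .inr <| .inr <| .inl
                ⟨f, ⟨hf, hl⟩, (h.loc hf).2, MSC.lt_not.2 h1, fun _ _ _ => trivial⟩
          · exact .inr <| .inr <| .inl ⟨⟨hp, hq⟩, hc⟩
        · exact .inr <| .inl ⟨v i, ⟨rfl, hp, hd⟩, hp, hq⟩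
      · exact .inl ⟨_, _, Or.inr hq, rfl, rfl⟩
    · exact .inl ⟨_, _, Or.inl hp, rfl, rfl⟩
  · rintro (⟨p', q', hne, rfl, rfl⟩ | ⟨_, ⟨rfl, -, hd⟩, -⟩ | ⟨-, hc⟩ | ⟨f, ⟨hf, hl⟩, -, hlt, -⟩ |
      ⟨f, ⟨hf, hl⟩, -, hlt, -⟩) hR
    · rcases hne with hne | hne
      · exact hne (h.loc hR).1
      · exact hne (h.loc hR).2
    · exact hd ⟨_, hR⟩
    · exact hc ⟨_, hR⟩
    · rw [← Bool.not_true, MSC.lt_not] at hlt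
      exact hlt.not_ord (hl _ hR)
    · exact (MSC.lt_not.2 hlt).not_ord (hl _ hR)

theorem not [Finite P] (h : Def Φ) : Def fun M v => ¬ Φ M v := by
  induction h with
  | lit h i j => exact not_lit h i j
  | const c => exact const _
  | and _ _ ih ih' => exact (ih.or ih').congr fun _ _ => not_and_or
  | or _ _ ih ih' => exact (ih.and ih').congr fun _ _ => not_or

/-- Evaluation at one single event. -/
theorem diag (h : Def Φ) : Rec fun M e => Φ M fun _ => e := by
  induction h with
  | lit h i j => exact h.loop
  | const c => exact Rec.node fun _ _ => c
  | and _ _ ih ih' => exact ih.and ih'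
  | or _ _ ih ih' => exact ih.or ih'

end Def

/-! ### Elimination of an existential quantifier -/

/-- A conjunction of constraints on an event `y` of the process `q`: path expressions from the events
assigned to variables to `y`, and a test at `y`. -/
structure Clause (P : Type u) (A : Type v) (V : Type) (q : P) where
  /-- the constraint that does not involve `y` -/
  rest : ∀ M : MSC P A, (V → M.E) → Prop
  def_rest : Def rest
  /-- the path expressions -/
  items : List (V × EvRel P A)
  path_items : ∀ x ∈ items, ∃ p, EvPath p q x.2
  /-- the test -/
  test : ∀ M : MSC P A, M.E → Prop
  rec_test : Rec test

namespace Clause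

variable {V : Type} {q : P}

/-- The event `y` satisfies the clause. -/
def Holds (T : Clause P A V q) (M : MSC P A) (v : V → M.E) (y : M.E) : Prop :=
  T.rest M v ∧ (∀ x ∈ T.items, x.2 M (v x.1) y) ∧ T.test M y

/-- The conjunction of two clauses. -/
def inter (T T' : Clause P A V q) : Clause P A V q where
  rest M v := T.rest M v ∧ T'.rest M v
  def_rest := T.def_rest.and T'.def_rest
  items := T.items ++ T'.items
  path_items x hx := (List.mem_append.1 hx).elim (T.path_items x) (T'.path_items x)
  test M y := T.test M y ∧ T'.test M y
  rec_test := T.rec_test.and T'.rec_test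

theorem holds_inter (T T' : Clause P A V q) (M : MSC P A) (v : V → M.E) (y : M.E) :
    (T.inter T').Holds M v y ↔ T.Holds M v y ∧ T'.Holds M v y := by
  simp only [Holds, inter, List.mem_append, or_imp, forall_and]
  tauto

theorem rec_forall_codom (l : List (V × EvRel P A)) (hl : ∀ x ∈ l, ∃ p, EvPath p q x.2) :
    Rec fun M y => ∀ x ∈ l, ∃ e, x.2 M e y := by
  induction l with
  | nil => exact Rec.top.congr fun _ _ => by simp
  | cons x l ih =>
    obtain ⟨p, hp⟩ := hl x (by simp)
    exact (hp.codom.and (ih fun x hx => hl x (by simp [hx]))).congr fun _ _ => by simp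

/-- Helly's theorem for the intervals given by path expressions. -/
theorem def_exists_of_ne_nil (T : Clause P A V q) (hT : T.items ≠ []) :
    Def fun M v => ∃ y, T.Holds M v y := by
  -- Images are convex only within their own codomain, so membership in all the codomains is added
  -- to the test.
  have hZ := T.rec_test.and (rec_forall_codom T.items T.path_items)
  have h1 : Def fun M v => ∀ x ∈ T.items, ∀ x' ∈ T.items, ∃ y,
      (x.2 M (v x.1) y ∧ T.test M y ∧ ∀ x ∈ T.items, ∃ e, x.2 M e y) ∧ x'.2 M (v x'.1) y := by
    refine Def.forall_mem _ fun x hx => Def.forall_mem _ fun x' hx' => ?_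
    obtain ⟨p, hp⟩ := T.path_items x hx
    obtain ⟨p', hp'⟩ := T.path_items x' hx'
    exact Def.lit ((hp.restrict hZ).comp hp'.inv) x.1 x'.1
  refine (T.def_rest.and h1).congr fun M v => ?_
  constructor
  · rintro ⟨y, h2, h3, h4⟩
    exact ⟨h2, fun x hx x' hx' => ⟨y, ⟨h3 x hx, h4, fun z hz => ⟨_, h3 z hz⟩⟩, h3 x' hx'⟩⟩
  · rintro ⟨h2, h3⟩
    have hleast : ∀ x ∈ T.items, ∃ m, (x.2 M (v x.1) m ∧ T.test M m ∧
        ∀ x ∈ T.items, ∃ e, x.2 M e m) ∧ ∀ y, (x.2 M (v x.1) y ∧ T.test M y ∧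
        ∀ x ∈ T.items, ∃ e, x.2 M e y) → M.ord true m y := by
      intro x hx
      obtain ⟨p, hp⟩ := T.path_items x hx
      obtain ⟨y, hy, -⟩ := h3 x hx x hx
      exact MSC.exists_least true ⟨y, hy⟩ fun y hy => (hp.loc hy.1).2
    have := M.nonempty_E
    choose! m hm hmin using hleast
    -- The latest of the minima is the common point. For each `x'` it lies between the minimum for
    -- `x'` and a point shared by the images for `x` and `x'`, so convexity applies.
    obtain ⟨x, hx, hmax⟩ := (List.finite_toSet T.items).exists_maximalFor
      (fun x => M.pos true (m x)) _ (List.exists_mem_of_ne_nil _ hT)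
    refine ⟨m x, h2, fun x' hx' => ?_, (hm x hx).2.1⟩
    obtain ⟨p, hp⟩ := T.path_items x hx
    obtain ⟨p', hp'⟩ := T.path_items x' hx'
    obtain ⟨y, hy, hy'⟩ := h3 x hx x' hx'
    obtain ⟨e, he⟩ := (hm x hx).2.2 x' hx'
    refine hp'.convex (hm x' hx').1 hy' he ⟨?_, ?_⟩ (hmin x hx y hy)
    · exact (hp'.loc (hm x' hx').1).2.trans (hp.loc (hm x hx).1).2.symm
    · by_contra hc
      exact hc (hmax hx' (by dsimp only; omega))

theorem def_exists [Finite P] [Nonempty V] (T : Clause P A V q) :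
    Def fun M v => ∃ y, M.loc y = q ∧ T.Holds M v y := by
  obtain ⟨i⟩ := ‹Nonempty V›
  have key : ∀ p, Def fun M v => ∃ y, (M.loc (v i) = p ∧ M.loc y = q) ∧ T.Holds M v y := by
    intro p
    -- The Helly argument needs at least one path to `y`. A jump from an arbitrary variable provides
    -- it, once the process of that variable is fixed.
    let T' : Clause P A V q :=
      { T with
        items := (i, fun M e f => M.loc e = p ∧ M.loc f = q) :: T.items
        path_items := by
          intro x hx
          rcases List.mem_cons.1 hx with rfl | hx
          · exact ⟨p, .jump p q⟩
          · exact T.path_items x hx }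
    refine (def_exists_of_ne_nil T' (by simp [T'])).congr fun M v => ?_
    refine exists_congr fun y => ?_
    simp only [Holds, T', List.forall_mem_cons]
    tauto
  refine (Def.iExists key).congr fun M v => ?_
  simp

end Clause

namespace Def

variable {V : Type}

/-- Disjunctive normal form with respect to `y`. Paths leaving `y` are inverted, and paths from `y`
to itself become tests by `EvPath.loop`. -/
theorem exists_clauses {Φ : ∀ M : MSC P A, (Option V → M.E) → Prop} (h : Def Φ) (q : P) :
    ∃ Ts : List (Clause P A V q), ∀ (M : MSC P A) (v : V → M.E) (y : M.E), M.loc y = q →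
      (Φ M (fun o => o.elim y v) ↔ ∃ T ∈ Ts, T.Holds M v y) := by
  induction h with
  | @lit p r R h i j =>
    have item : ∀ (i : V) {p r : P} {R : EvRel P A}, EvPath p r R → ∃ Ts : List (Clause P A V q),
        ∀ (M : MSC P A) (v : V → M.E) (y : M.E), M.loc y = q →
          (R M (v i) y ↔ ∃ T ∈ Ts, T.Holds M v y) := by
      intro i p r R h
      by_cases hr : r = q
      · subst hr
        refine ⟨[⟨_, .const True, [(i, R)], fun x hx => ?_, _, Rec.top⟩], fun M v y hy => ?_⟩
        · obtain rfl := List.mem_singleton.1 hx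
          exact ⟨p, h⟩
        · simp [Clause.Holds]
      · refine ⟨[], fun M v y hy => ?_⟩
        simp only [List.not_mem_nil, false_and, exists_false, iff_false]
        exact fun hR => hr ((h.loc hR).2.symm.trans hy)
    rcases i with _ | i <;> rcases j with _ | j
    · exact ⟨[⟨_, .const True, [], by simp, _, h.loop⟩], fun M v y hy => by simp [Clause.Holds]⟩
    · exact item j h.inv
    · exact item i h
    · exact ⟨[⟨_, .lit h i j, [], by simp, _, Rec.top⟩], fun M v y hy => by simp [Clause.Holds]⟩
  | const c =>
    exact ⟨[⟨_, .const c, [], by simp, _, Rec.top⟩], fun M v y hy => by simp [Clause.Holds]⟩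
  | and _ _ ih ih' =>
    obtain ⟨Ts, h⟩ := ih
    obtain ⟨Ts', h'⟩ := ih'
    refine ⟨Ts.flatMap fun T => Ts'.map fun T' => T.inter T', fun M v y hy => ?_⟩
    refine (and_congr (h M v y hy) (h' M v y hy)).trans ?_
    simp only [List.mem_flatMap, List.mem_map]
    constructor
    · rintro ⟨⟨T, hT, h1⟩, T', hT', h2⟩
      exact ⟨_, ⟨T, hT, T', hT', rfl⟩, (Clause.holds_inter ..).2 ⟨h1, h2⟩⟩
    · rintro ⟨_, ⟨T, hT, T', hT', rfl⟩, h1⟩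
      rw [Clause.holds_inter] at h1
      exact ⟨⟨T, hT, h1.1⟩, T', hT', h1.2⟩
  | or _ _ ih ih' =>
    obtain ⟨Ts, h⟩ := ih
    obtain ⟨Ts', h'⟩ := ih'
    refine ⟨Ts ++ Ts', fun M v y hy => ?_⟩
    refine (or_congr (h M v y hy) (h' M v y hy)).trans ?_
    simp only [List.mem_append, or_and_right, exists_or]

theorem ex [Finite P] [Nonempty V] {Φ : ∀ M : MSC P A, (Option V → M.E) → Prop} (h : Def Φ) :
    Def fun M (v : V → M.E) => ∃ y, Φ M fun o => o.elim y v := by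
  choose Ts hTs using h.exists_clauses
  refine (iExists fun q => exists_mem (Ts q) fun T _ => T.def_exists).congr fun M v => ?_
  constructor
  · rintro ⟨y, hy⟩
    obtain ⟨T, hT, h1⟩ := (hTs _ M v y rfl).1 hy
    exact ⟨_, T, hT, y, rfl, h1⟩
  · rintro ⟨q, T, hT, y, hy, h1⟩
    exact ⟨y, (hTs q M v y hy).2 ⟨T, hT, h1⟩⟩

end Def

/-! ### The happened-before order as bounded reachability -/

theorem reflTransGen_mono {α : Type*} {r s : α → α → Prop} (h : ∀ x y, r x y → s x y) {x y : α}
    (hxy : Relation.ReflTransGen r x y) : Relation.ReflTransGen s x y :=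
  Relation.ReflTransGen.mono h x y hxy

namespace MSC

/-- There is a path of process edges and of at most `n` message edges from `e` to `f`. -/
def reach (M : MSC P A) : ℕ → M.E → M.E → Prop
  | 0, e, f => M.ord true e f
  | n + 1, e, f => M.ord true e f ∨ ∃ g h, M.ord true e g ∧ M.msg g h ∧ reach M n h f

variable {M : MSC P A}

theorem ord.le {e f : M.E} (h : M.ord true e f) : M.le e f :=
  reflTransGen_mono (fun _ _ => Or.inl) (leProc_iff.2 h)

theorem le_of_reach {n : ℕ} {e f : M.E} (h : M.reach n e f) : M.le e f := by
  induction n generalizing e with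
  | zero => exact ord.le h
  | succ n ih =>
    rcases h with h | ⟨g, k, h1, h2, h3⟩
    · exact ord.le h
    · exact (ord.le h1).trans (.head (Or.inr h2) (ih h3))

theorem ord_of_le {e f : M.E} (h : M.le e f) (hl : M.loc e = M.loc f) : M.ord true e f := by
  rcases ord_or_lt true hl with h1 | h1
  · exact h1
  · obtain ⟨g, hg, hge⟩ := h1.exists_nx
    exact (M.acyclic f ((Relation.TransGen.head' (b := g) (Or.inl hg) (ord.le hge)).trans_left h)).elim

/-- A path is split at the last event of the process `p`. -/
theorem split_last {S : Finset P} [DecidableEq P] (p : P) {e f : M.E} (h : Relation.ReflTransGen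
      (fun x y => (M.next x y ∨ M.msg x y) ∧ M.loc x ∈ S ∧ M.loc y ∈ S) e f) :
    M.loc e ≠ p ∨ M.loc f = p ∨ ∃ g k, M.loc g = p ∧ M.le e g ∧ (M.next g k ∨ M.msg g k) ∧
      M.loc g ∈ S ∧ M.loc k ≠ p ∧ M.loc f ≠ p ∧ Relation.ReflTransGen (fun x y =>
        (M.next x y ∨ M.msg x y) ∧ M.loc x ∈ S.erase p ∧ M.loc y ∈ S.erase p) k f := by
  induction h with
  | refl => exact (em (M.loc e = p)).elim (fun h => .inr (.inl h)) .inl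
  | @tail f f' hef hff' ih =>
    by_cases hf' : M.loc f' = p
    · exact .inr (.inl hf')
    by_cases hf : M.loc f = p
    · exact .inr (.inr ⟨f, f', hf, reflTransGen_mono (fun _ _ h => h.1) hef, hff'.1, hff'.2.1, hf', hf', .refl⟩)
    rcases ih with ih | ih | ⟨g, k, h1, h2, h3, h4, h5, h6, h7⟩
    · exact .inl ih
    · exact absurd ih hf
    · exact .inr (.inr ⟨g, k, h1, h2, h3, h4, h5, hf', h7.tail
        ⟨hff'.1, Finset.mem_erase.2 ⟨hf, hff'.2.1⟩, Finset.mem_erase.2 ⟨hf', hff'.2.2⟩⟩⟩)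

/-- Induction on the set of processes that the path may visit: go straight to the last event of the
path on the current process and leave by a message edge. The rest of the path avoids that process.
-/
theorem reach_of_path [DecidableEq P] {n : ℕ} {S : Finset P} (hS : S.card ≤ n) {e f : M.E}
    (h : Relation.ReflTransGen
      (fun x y => (M.next x y ∨ M.msg x y) ∧ M.loc x ∈ S ∧ M.loc y ∈ S) e f) :
    M.reach n e f := by
  induction n generalizing S e with
  | zero =>
    obtain rfl : S = ∅ := Finset.card_eq_zero.1 (Nat.le_zero.1 hS)
    rcases Relation.ReflTransGen.cases_head h with rfl | ⟨g, hg, -⟩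
    · exact ord_refl true e
    · exact absurd hg.2.1 (Finset.notMem_empty _)
  | succ n ih =>
    rcases split_last (M.loc e) h with h1 | h1 | ⟨g, k, h1, h2, h3, h4, h5, -, h6⟩
    · exact absurd rfl h1
    · exact Or.inl (ord_of_le (reflTransGen_mono (fun _ _ h => h.1) h) h1.symm)
    · refine Or.inr ⟨g, k, ord_of_le h2 h1.symm, h3.resolve_left fun hn => ?_, ih ?_ h6⟩
      · exact h5 ((M.next_loc _ _ hn).symm.trans h1)
      · rw [Finset.card_erase_of_mem (h1 ▸ h4)]
        omega

theorem le_iff_reach [Fintype P] {e f : M.E} : M.le e f ↔ M.reach (Fintype.card P) e f := by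
  classical
  refine ⟨fun h => reach_of_path (S := Finset.univ) le_rfl ?_, le_of_reach⟩
  exact reflTransGen_mono
    (fun _ _ h => ⟨h, Finset.mem_univ _, Finset.mem_univ _⟩) h

end MSC

/-! ### Translation of first-order formulas -/

namespace Def

variable {V : Type} [Finite P]

theorem unary {X : ∀ M : MSC P A, M.E → Prop} (hX : Rec X) (i : V) : Def fun M v => X M (v i) :=
  (iExists fun p => lit (.test p X hX) i i).congr fun _ _ => by simp

theorem eq (i j : V) : Def fun (_ : MSC P A) v => v i = v j :=
  (iExists fun p => lit (.test p _ Rec.top) i j).congr fun M v => by simp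

theorem next (i j : V) : Def fun (M : MSC P A) v => M.next (v i) (v j) := by
  refine (iExists fun p => lit (.upto true p _ Rec.bot) i j).congr fun M v => ?_
  constructor
  · intro h
    have h1 : M.nx true (v i) (v j) := h
    exact ⟨_, rfl, h1.lt, fun g hg hg' => hg'.not_ord (h1.ord_of_lt hg)⟩
  · rintro ⟨p, -, h1, h2⟩
    obtain ⟨g, hg, hgj⟩ := h1.exists_nx
    rcases MSC.eq_or_lt_of_ord hgj with h3 | h3
    · exact h3 ▸ hg
    · exact (h2 g hg.lt h3).elim

theorem msg (i j : V) : Def fun (M : MSC P A) v => M.msg (v i) (v j) :=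
  (iExists fun p => iExists fun q => lit (.msg p q) i j).congr fun M v => by simp

theorem ord (i j : V) : Def fun (M : MSC P A) v => M.ord true (v i) (v j) := by
  refine ((eq i j).or (iExists fun p => lit (.upto true p _ Rec.top) i j)).congr fun M v => ?_
  simp only [implies_true, and_true, exists_eq_left']
  constructor
  · exact MSC.eq_or_lt_of_ord
  · rintro (h | h)
    · exact h ▸ MSC.ord_refl true _
    · exact h.ord

theorem reach (n : ℕ) {V : Type} (i j : V) : Def fun (M : MSC P A) v => M.reach n (v i) (v j) := by
  induction n generalizing V with
  | zero => exact ord i j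
  | succ n ih =>
    have : Nonempty V := ⟨i⟩
    -- The two fresh variables are `some none` for the send event and `none` for the receive event.
    exact (ord i j).or (((ord (some (some i)) (some none)).and
      ((msg (some none) none).and (ih none (some (some j))))).ex.ex)

theorem le (i j : V) : Def fun (M : MSC P A) v => M.le (v i) (v j) := by
  have := Fintype.ofFinite P
  exact (reach (Fintype.card P) i j).congr fun M v => MSC.le_iff_reach

open FirstOrder Language in
/-- First-order formulas are positive Boolean combinations of path expressions; the variable `none`
does not occur in the formula. -/
theorem of_formula {n : ℕ} (φ : (mscSignature P A).BoundedFormula Empty n) :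
    Def fun (M : MSC P A) (v : Option (Fin n) → M.E) =>
      φ.Realize (M := M.E) default fun i => v (some i) := by
  have term : ∀ {n : ℕ} (t : (mscSignature P A).Term (Empty ⊕ Fin n)), ∃ i : Fin n,
      ∀ (M : MSC P A) (x : Fin n → M.E), t.realize (Sum.elim (default : Empty → M.E) x) = x i := by
    intro n t
    cases t with
    | var i =>
      rcases i with i | i
      · exact i.elim
      · exact ⟨i, fun M x => rfl⟩
    | func f _ => exact Empty.elim f
  induction φ with
  | falsum => exact const False
  | equal t₁ t₂ =>
    obtain ⟨i, hi⟩ := term t₁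
    obtain ⟨j, hj⟩ := term t₂
    refine (eq (some i) (some j)).congr fun M v => ?_
    simp only [BoundedFormula.Realize, hi, hj]
  | rel R ts =>
    choose i hi using fun k => term (ts k)
    simp only [BoundedFormula.Realize, hi]
    change MSCRel P A _ at R
    cases R with
    | proc p => exact unary (Rec.node fun l _ => l = p) (some (i 0))
    | label a => exact unary (Rec.node fun _ l => l = a) (some (i 0))
    | next => exact next (some (i 0)) (some (i 1))
    | msg => exact msg (some (i 0)) (some (i 1))
    | le => exact le (some (i 0)) (some (i 1))
  | imp _ _ ih ih' =>
    refine (ih.not.or ih').congr fun M v => ?_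
    simp only [BoundedFormula.Realize]
    exact imp_iff_not_or
  | @all n φ ih =>
    -- The last variable of the body becomes the quantified one, and the spare variable moves to
    -- `some none`. The spare keeps the set of variables nonempty, as `Def.ex` requires, even for
    -- sentences.
    refine ((ih.not.reindex fun o => o.elim (some none)
      (Fin.lastCases none fun i => some (some i))).ex.not).congr fun M v => ?_
    simp only [BoundedFormula.Realize, not_exists, not_not, Option.elim]
    refine forall_congr' fun y => iff_of_eq (congrArg _ (funext fun i => ?_))
    induction i using Fin.lastCases with
    | last => simp
    | cast i => simp

end Def

theorem proposition2 (P : Type u) (A : Type v) [Finite P] [Nonempty P] [Finite A] [Nonempty A] :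
    FODefinable P A ⊆ CFMRecognizable P A := by
  rintro _ ⟨φ, rfl⟩
  -- Every event is labelled with the truth value of the sentence, the spare variable being assigned
  -- to that event, and all labels are required to be true. As MSCs are nonempty, this says that the
  -- sentence holds.
  obtain ⟨C, hC⟩ := ((Recog.node fun _ _ (x : Unit × Prop) => x.2).subst
    (Def.of_formula φ).diag).cfm
  refine ⟨C, Set.ext fun M => ?_⟩
  rw [hC]
  have := M.nonempty_E
  have key : ∀ e : M.E, FirstOrder.Language.BoundedFormula.Realize (M := M.E) φ default
      (fun _ => e) ↔ M ∈ foLanguage φ := fun e => by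
    rw [Subsingleton.elim (fun _ => e) (default : Fin 0 → M.E)]
    rfl
  simp [key]
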